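/- **Theorem.** Let $\mathcal C$ be a locally small category which is complete (has all small limits) and sifted-cocomplete (has all colimits indexed by small sifted categories). Let $\mathcal S\mathrm{ind}(\mathcal C)$ be the closure of the representable presheaves in $[\mathcal C^{\mathrm{op}},\mathbf{Set}]$ under small sifted colimits, and let $W\colon \mathcal C\to \mathcal S\mathrm{ind}(\mathcal C)$ be the restricted Yoneda embedding. Call $\mathcal C$ *algebraically exact* if $W$ has a left adjoint that is continuous (preserves small limits). Then $\mathcal C$ is algebraically exact if and only if it satisfies all of the following conditions: - **(E1)** $\mathcal C$ is Barr-exact: it is regular (it has finite limits and coequalisers of kernel pairs, and regular epimorphisms are stable under pullback) and every equivalence relation in $\mathcal C$ is effective, i.e. is the kernel pair of its coequaliser. - **(E2)** Finite limits commute with small filtered colimits in $\mathcal C$: for each small filtered category $\mathcal K$, the functor $\mathrm{colim}\colon[\mathcal K,\mathcal C]\to\mathcal C$ preserves finite limits. - **(E3)** Regular epimorphisms are stable under small products: if $(f_i\colon X_i\to Y_i)_{i\in I}$ is a small family of regular epimorphisms in $\mathcal C$, then $\prod_i f_i\colon \prod_i X_i\to\prod_i Y_i$ is a regular epimorphism.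 - **(E4)** Filtered colimits distribute over small products: if $(D_i\colon \mathcal A_i\to\mathcal C)_{i\in I}$ is a small family of diagrams indexed by small filtered categories, with colimit cocones $(q_{i,a}\colon D_i(a)\to X_i)_{a\in\mathcal A_i}$, then the morphisms $\prod_i q_{i,a_i}\colon\prod_i D_i(a_i)\to\prod_i X_i$ form a colimit cocone under the diagram $\prod_i\mathcal A_i\to\mathcal C$, $(a_i)_i\mapsto\prod_i D_i(a_i)$. -/

import Mathlib

open CategoryTheory CategoryTheory.Limits

universe v u

namespace AlgExact

section

variable (C : Type u) [Category.{v} C]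

/-- `C` is sifted-cocomplete: it has colimits of every shape that is a small sifted category.
The size of "small" is the universe `v` of the hom-sets of `C`, so that `C` is locally small. -/
class HasSiftedColimits : Prop where
  hasColimitsOfShape : ∀ (K : Type v) [SmallCategory K] [IsSifted K], HasColimitsOfShape K C

/-- Filtered categories are sifted, so a sifted-cocomplete category has small filtered colimits. -/
instance [HasSiftedColimits C] : HasFilteredColimitsOfSize.{v, v} C where
  HasColimitsOfShape K _ _ :=
    have : IsSifted K := IsFiltered.isSifted
    HasSiftedColimits.hasColimitsOfShape K

/-- The small sifted categories. -/
abbrev SiftedShape : Type (v + 1) := { K : Cat.{v, v} // IsSifted K }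

/-- The presheaves lying in the closure of the representables in `[Cᵒᵖ, Set]` under small sifted
colimits. -/
def siftedClosure : ObjectProperty (Cᵒᵖ ⥤ Type v) :=
  (yoneda (C := C)).essImage.colimitsClosure (fun K : SiftedShape.{v} => (K.1 : Type v))

/-- Every representable lies in the closure. -/
theorem siftedClosure_yoneda (X : C) : siftedClosure C (yoneda.obj X) :=
  ObjectProperty.le_colimitsClosure _ _ _ (yoneda.obj_mem_essImage X)

/-- The free completion `Sind(C)` of `C` under small sifted colimits, as a full subcategory of
the category of presheaves on `C`. -/
abbrev Sind : Type (max u (v + 1)) := (siftedClosure C).FullSubcategory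

/-- The restricted Yoneda embedding `W : C ⥤ Sind(C)`. -/
abbrev W : C ⥤ Sind C := (siftedClosure C).lift yoneda (siftedClosure_yoneda C)

/-- `C` is algebraically exact: `W : C ⥤ Sind(C)` has a left adjoint that preserves small
limits. -/
def IsAlgebraicallyExact : Prop :=
  ∃ L : Sind C ⥤ C, Nonempty (L ⊣ W C) ∧ PreservesLimitsOfSize.{v, v} L

/-- `C` is Barr-exact: it is regular (it has finite limits and coequalisers of kernel pairs, and
regular epimorphisms are stable under pullback), and every equivalence relation is effective
(it is the kernel pair of its coequaliser). -/
structure IsBarrExact : Prop where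
  regular : Regular C
  effective : ∀ {R A : C} (p₁ p₂ : R ⟶ A),
    IsEquivalenceRelation p₁ p₂ → IsEffectiveEquivalenceRelation p₁ p₂

/-- Finite limits commute with small filtered colimits in `C`: for each small filtered `K`, the
functor `colim : (K ⥤ C) ⥤ C` preserves finite limits. -/
def FiniteLimitsCommuteWithFilteredColimits [HasFilteredColimitsOfSize.{v, v} C] : Prop :=
  ∀ (K : Type v) [SmallCategory K] [IsFiltered K],
    PreservesFiniteLimits (colim : (K ⥤ C) ⥤ C)

/-- Regular epimorphisms are stable under small products in `C`. -/
def RegularEpisStableUnderProducts [HasProducts.{v} C] : Prop :=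
  ∀ (ι : Type v) (X Y : ι → C) (f : ∀ i, X i ⟶ Y i),
    (∀ i, IsRegularEpi (f i)) → IsRegularEpi (Limits.Pi.map f)

/-- Filtered colimits distribute over small products in `C`: given a small family of small filtered
categories `J i` and diagrams `F i : J i ⥤ C` with colimit cocones `c i`, the cocone with vertex
`∏ i, (c i).pt` under the diagram `(x i)_i ↦ ∏ i, (F i).obj (x i)` on the product category
`∏ i, J i` is again a colimit cocone. -/
def FilteredColimitsDistributeOverProducts [HasProducts.{v} C] : Prop :=
  ∀ (ι : Type v) (J : ι → Type v) [∀ i, SmallCategory (J i)] [∀ i, IsFiltered (J i)]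
    (F : ∀ i, J i ⥤ C) (c : ∀ i, Cocone (F i)),
    (∀ i, Nonempty (IsColimit (c i))) → Nonempty (IsColimit (coconePointwiseProduct c))

end

end AlgExact

/-!
A morphism `φ : F ⟶ yoneda.obj X` of presheaves is a *reflection* if it is universal among morphisms
from `F` to representable presheaves; a left adjoint of `W` is a choice of reflections for all
presheaves in `Sind C`. Both implications compare limits and colimits of presheaves with those of
their reflections.

*The exactness conditions imply algebraic exactness.* Let a sieve on `U` cover if it contains a
family of morphisms whose images form a small directed union equal to `U`. These sieves form a
Grothendieck topology in which, moreover, small intersections of covering sieves cover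
(`Covers.iInf`). Indeed directed unions are filtered colimits and stable under pullback, because
filtered colimits commute with finite limits; products of regular epimorphisms are regular
epimorphisms; and intersections distribute over directed unions, because filtered colimits
distribute over products. The same distributivity gives transitivity (`Covers.trans`). Representable
presheaves are sheaves, because regular epimorphisms and directed unions are colimits, so a locally
bijective morphism to a representable presheaf is a reflection (`ExactnessConditions.isReflection`).
Small limits of locally bijective morphisms are locally bijective, by closure of covers under small
intersections (`ExactnessConditions.isLocallyBijective_limit`).

It remains to see that every presheaf in `Sind C` admits a locally bijective morphism to a
representable one. Since locally bijective morphisms are stable under colimits, induction reduces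
this to a sifted colimit `P` of representables `yoneda.obj (X k)`. Two morphisms into `X k` become
equal in `P` exactly if they are connected by a zigzag in the diagram. The pairs connected by a
given zigzag are those that factor through a span (`ZigzagPath.exists_span`), and siftedness makes
the images of these spans a directed family of subobjects of `X k ⨯ X k`; its union is the local
kernel pair of `yoneda.obj (X k) ⟶ P` (`ExactnessConditions.exists_locallyEqual_iff_factors`). By
Barr-exactness `X k` has a quotient by this equivalence relation, and the quotients form a directed
diagram of monomorphisms, whose colimit represents `P` locally
(`ExactnessConditions.exists_isLocallyBijective_of_directed`).

*Algebraic exactness implies the exactness conditions.* Let `L` be a left adjoint of `W` that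
preserves small limits. Colimits in `C` are reflections of the colimits of the corresponding
representable presheaves (`isReflection_of_isColimit`, `isColimit_of_isReflection`), and limits of
reflections are reflections of the limits (`isReflection_of_isLimit_fan`,
`isPullback_of_isReflection`). The quotient presheaf of an equivalence relation is a reflexive
coequaliser of representables, hence lies in `Sind C`; it has the relation as kernel pair, and so
has its reflection. A morphism is a regular epimorphism exactly if the inclusion of its image
presheaf is a reflection (`isReflection_range_iff`), and image presheaves are stable under pullbacks
and products. The commutation of filtered colimits with finite limits and their distributivity over
products hold for presheaves and are transported in the same way.
-/

namespace AlgExact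

/-! ### Directed unions of subobjects -/

section DirectedUnions

variable {C : Type u} [Category.{v} C]

/-- The diagram of underlying objects of a monotone family of subobjects. -/
noncomputable abbrev underlyingDiagram {K : Type v} [Preorder K] {U : C} {A : K → Subobject U}
    (hA : Monotone A) : K ⥤ C where
  obj k := (A k : C)
  map f := (A _).ofLE (A _) (hA f.le)
  map_comp f g := (Subobject.ofLE_comp_ofLE _ _ _ _ _).symm

/-- The cocone of inclusions under a monotone family of subobjects with a given upper bound. -/
noncomputable abbrev underlyingCocone {K : Type v} [Preorder K] {U : C} {A : K → Subobject U}
    (hA : Monotone A) {B : Subobject U} (h : ∀ k, A k ≤ B) : Cocone (underlyingDiagram hA) where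
  pt := B
  ι :=
    { app := fun k => (A k).ofLE B (h k)
      naturality := fun k l f => by simp }

/-- If the members of a diagram are subobjects of `U` through a monomorphism out of its colimit,
then the colimit is their least upper bound. -/
theorem isLUB_mk_of_isColimit {J : Type*} [Category* J] {F : J ⥤ C} {c : Cocone F}
    (hc : IsColimit c) {U : C} (m : c.pt ⟶ U) [Mono m] (A : J → Subobject U)
    (hA : ∀ {j} {T : C} (f : T ⟶ U), (A j).Factors f ↔ ∃ g : T ⟶ F.obj j, g ≫ c.ι.app j ≫ m = f) :
    IsLUB (Set.range A) (Subobject.mk m) := by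
  have key : ∀ j (B : Subobject U), A j ≤ B ↔ B.Factors (c.ι.app j ≫ m) := fun j B =>
    ⟨fun h => Subobject.factors_of_le _ h ((hA _).2 ⟨𝟙 _, by simp⟩), fun h =>
      Subobject.le_of_factors (by
        obtain ⟨g, hg⟩ := (hA (A j).arrow).1 (Subobject.factors_self _)
        rw [← hg]
        exact Subobject.factors_of_factors_right _ h)⟩
  constructor
  · rintro _ ⟨j, rfl⟩
    rw [key]
    exact (Subobject.mk_factors_iff _ _).2 ⟨c.ι.app j, rfl⟩
  · intro B hB
    have hB' : ∀ j, B.Factors (c.ι.app j ≫ m) := fun j => (key j B).1 (hB ⟨j, rfl⟩)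
    let s : Cocone F :=
      { pt := (B : C)
        ι :=
          { app := fun j => B.factorThru _ (hB' j)
            naturality := fun i j f => by
              apply Subobject.eq_of_comp_arrow_eq
              simp } }
    refine Subobject.mk_le_of_comm (hc.desc s) (hc.hom_ext fun j => ?_)
    simp [s, hc.fac_assoc]

variable [HasSiftedColimits C]

/-- If finite limits commute with filtered colimits, then filtered colimits of monomorphisms are
monomorphisms. -/
theorem FiniteLimitsCommuteWithFilteredColimits.mono_desc [HasFiniteLimits C]
    (hC : FiniteLimitsCommuteWithFilteredColimits C) {K : Type v} [SmallCategory K] [IsFiltered K]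
    {F G : K ⥤ C} {c : Cocone F} (hc : IsColimit c) {d : Cocone G} (hd : IsColimit d) (τ : F ⟶ G)
    [∀ k, Mono (τ.app k)] (m : c.pt ⟶ d.pt) (hm : ∀ k, c.ι.app k ≫ m = τ.app k ≫ d.ι.app k) :
    Mono m := by
  have := hC K
  have : Mono τ := NatTrans.mono_of_mono_app τ
  have e : m = (hc.coconePointUniqueUpToIso (colimit.isColimit F)).hom ≫
      colim.map τ ≫ (hd.coconePointUniqueUpToIso (colimit.isColimit G)).inv := by
    refine hc.hom_ext fun k => ?_
    rw [hm]
    simp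
  rw [e]
  infer_instance

/-- Filtered colimits are stable under pullback as soon as they commute with finite limits. -/
theorem FiniteLimitsCommuteWithFilteredColimits.isPullback [HasFiniteLimits C]
    (hC : FiniteLimitsCommuteWithFilteredColimits C) {K : Type v} [SmallCategory K] [IsFiltered K]
    {F F' : K ⥤ C} {c : Cocone F} (hc : IsColimit c) {c' : Cocone F'} (hc' : IsColimit c')
    {U V : C} {f : V ⟶ U} {g : c'.pt ⟶ c.pt} {m : c.pt ⟶ U} {m' : c'.pt ⟶ V} (σ : F' ⟶ F)
    (hg : ∀ k, c'.ι.app k ≫ g = σ.app k ≫ c.ι.app k)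
    {a : ∀ k, F.obj k ⟶ U} (ha : ∀ k, c.ι.app k ≫ m = a k)
    {a' : ∀ k, F'.obj k ⟶ V} (ha' : ∀ k, c'.ι.app k ≫ m' = a' k)
    (h : ∀ k, IsPullback (σ.app k) (a' k) (a k) f) :
    IsPullback g m' m f := by
  have := hC K
  have : IsConnected K := IsFiltered.isConnected K
  obtain rfl : (fun k => c.ι.app k ≫ m) = a := funext ha
  obtain rfl : (fun k => c'.ι.app k ≫ m') = a' := funext ha'
  let τ : F ⟶ (Functor.const K).obj U := c.ι ≫ (Functor.const K).map m
  let τ' : F' ⟶ (Functor.const K).obj V := c'.ι ≫ (Functor.const K).map m'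
  have hp : IsPullback σ τ' τ ((Functor.const K).map f) :=
    IsPullback.of_forall_isPullback_app fun k => by simpa [τ, τ'] using h k
  have hiso : ∀ {G : K ⥤ C} {d : Cocone G} (_ : IsColimit d),
      ∃ e : colimit G ≅ d.pt, ∀ k, colimit.ι G k ≫ e.hom = d.ι.app k :=
    fun hd => ⟨(colimit.isColimit _).coconePointUniqueUpToIso hd,
      fun k => IsColimit.comp_coconePointUniqueUpToIso_hom _ _ _⟩
  have hconst : ∀ Y : C, ∃ e : colimit ((Functor.const K).obj Y) ≅ Y,
      ∀ k, colimit.ι ((Functor.const K).obj Y) k ≫ e.hom = 𝟙 Y :=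
    fun Y => hiso (isColimitConstCocone K Y)
  obtain ⟨e, he⟩ := hiso hc
  obtain ⟨e', he'⟩ := hiso hc'
  obtain ⟨eU, heU⟩ := hconst U
  obtain ⟨eV, heV⟩ := hconst V
  refine (hp.map (colim : (K ⥤ C) ⥤ C)).of_iso e' e eV eU ?_ ?_ ?_ ?_
  all_goals
    refine colimit.hom_ext fun k => ?_
    have hUk := heU k
    have hVk := heV k
    dsimp at hUk hVk ⊢
    simp [τ, τ', hg, he, hUk, hVk, reassoc_of% he, reassoc_of% he', reassoc_of% hVk]

/-- A directed family of subobjects has a union, whose underlying object is the colimit of the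
underlying objects. -/
theorem exists_isLUB_of_monotone [HasFiniteLimits C]
    (hC : FiniteLimitsCommuteWithFilteredColimits C) {K : Type v} [Nonempty K] [Preorder K]
    [IsDirectedOrder K] {U : C} {A : K → Subobject U} (hA : Monotone A) :
    ∃ (B : Subobject U) (h : ∀ k, A k ≤ B), IsLUB (Set.range A) B ∧
      Nonempty (IsColimit (underlyingCocone hA h)) := by
  have : IsConnected K := IsFiltered.isConnected K
  let F := underlyingDiagram hA
  let τ : F ⟶ (Functor.const K).obj U :=
    { app := fun k => (A k).arrow
      naturality := fun k l f => by simp [F] }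
  have : ∀ k, Mono (τ.app k) := fun k => inferInstanceAs (Mono (A k).arrow)
  let m : colimit F ⟶ U := colimit.desc F ⟨U, τ⟩
  have hm : ∀ k, colimit.ι F k ≫ m = (A k).arrow := fun k => colimit.ι_desc _ _
  have : Mono m := hC.mono_desc (colimit.isColimit F) (isColimitConstCocone K U) τ m
    (fun k => (hm k).trans (Category.comp_id _).symm)
  have hB : IsLUB (Set.range A) (Subobject.mk m) := by
    refine isLUB_mk_of_isColimit (colimit.isColimit F) m A fun {k T} f => ?_
    have := hm k
    dsimp at this ⊢
    rw [this, Subobject.factors_iff]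
    rfl
  have hle : ∀ k, A k ≤ Subobject.mk m := fun k => hB.1 ⟨k, rfl⟩
  refine ⟨_, hle, hB, ⟨(colimit.isColimit F).ofIsoColimit
    (Cocone.ext (Subobject.underlyingIso m).symm fun k => ?_)⟩⟩
  apply Subobject.eq_of_comp_arrow_eq
  simp [hm]

/-- A directed union of subobjects is the colimit of the subobjects. -/
theorem isColimit_of_isLUB [HasFiniteLimits C]
    (hC : FiniteLimitsCommuteWithFilteredColimits C) {K : Type v} [Nonempty K] [Preorder K]
    [IsDirectedOrder K] {U : C} {A : K → Subobject U}
    (hA : Monotone A) {B : Subobject U} (h : IsLUB (Set.range A) B) (hle : ∀ k, A k ≤ B) :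
    Nonempty (IsColimit (underlyingCocone hA hle)) := by
  obtain ⟨B', hle', h', hc⟩ := exists_isLUB_of_monotone hC hA
  obtain rfl := h.unique h'
  exact hc

theorem isDirectedOrder_lift {α K : Type*} [Preorder α] {A : K → α} (hA : Directed (· ≤ ·) A) :
    letI := Preorder.lift A
    IsDirectedOrder K :=
  letI := Preorder.lift A
  ⟨fun k l => hA k l⟩

theorem exists_isLUB [HasFiniteLimits C]
    (hC : FiniteLimitsCommuteWithFilteredColimits C) {K : Type v} [Nonempty K] {U : C}
    {A : K → Subobject U} (hA : Directed (· ≤ ·) A) :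
    ∃ B : Subobject U, IsLUB (Set.range A) B :=
  letI := Preorder.lift A
  have := isDirectedOrder_lift hA
  let ⟨B, _, hB, _⟩ := exists_isLUB_of_monotone hC (A := A) fun _ _ h => h
  ⟨B, hB⟩

/-- Directed unions of subobjects are stable under pullback. -/
theorem isLUB_pullback [HasFiniteLimits C]
    (hC : FiniteLimitsCommuteWithFilteredColimits C) {K : Type v} [Nonempty K]
    {U V : C} (f : V ⟶ U) {A : K → Subobject U} (hA : Directed (· ≤ ·) A)
    {B : Subobject U} (hB : IsLUB (Set.range A) B) :
    IsLUB (Set.range fun k => (Subobject.pullback f).obj (A k))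
      ((Subobject.pullback f).obj B) := by
  let := Preorder.lift A
  have := isDirectedOrder_lift hA
  have hA₁ : Monotone A := fun _ _ h => h
  have hA₂ : Monotone fun k => (Subobject.pullback f).obj (A k) :=
    fun k l h => (Subobject.pullback f).monotone h
  obtain ⟨B', hle', hB', ⟨hc'⟩⟩ := exists_isLUB_of_monotone hC hA₂
  have hle₁ : ∀ k, A k ≤ B := fun k => hB.1 ⟨k, rfl⟩
  obtain ⟨hc⟩ := isColimit_of_isLUB hC hA₁ hB hle₁
  suffices B' = (Subobject.pullback f).obj B by rwa [← this]
  have hle : B' ≤ (Subobject.pullback f).obj B :=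
    hB'.2 (by rintro _ ⟨k, rfl⟩; exact (Subobject.pullback f).monotone (hle₁ k))
  have hnat : ∀ k l (i : k ⟶ l), ((Subobject.pullback f).obj (A k)).ofLE _ (hA₂ i.le) ≫
      Subobject.pullbackπ f (A l) =
        Subobject.pullbackπ f (A k) ≫ (A k).ofLE _ (hA₁ i.le) := by
    intro k l i
    apply Subobject.eq_of_comp_arrow_eq
    simp only [Category.assoc, (Subobject.isPullback f _).w, Subobject.ofLE_arrow,
      Subobject.ofLE_arrow_assoc]
  have hι : ∀ k, ((Subobject.pullback f).obj (A k)).ofLE B' (hle' k) ≫ B'.ofLE _ hle ≫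
      Subobject.pullbackπ f B = Subobject.pullbackπ f (A k) ≫ (A k).ofLE B (hle₁ k) := by
    intro k
    apply Subobject.eq_of_comp_arrow_eq
    simp only [Category.assoc, (Subobject.isPullback f _).w, Subobject.ofLE_arrow,
      Subobject.ofLE_arrow_assoc]
  have hp : IsPullback (B'.ofLE _ hle ≫ Subobject.pullbackπ f B) B'.arrow B.arrow f :=
    hC.isPullback hc hc'
      { app := fun k => Subobject.pullbackπ f (A k)
        naturality := fun k l i => hnat k l i } (fun k => hι k)
      (fun k => Subobject.ofLE_arrow (hle₁ k)) (fun k => Subobject.ofLE_arrow (hle' k))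
      fun k => Subobject.isPullback f (A k)
  rw [← Subobject.mk_arrow B, ← Subobject.mk_arrow B', Subobject.pullback_obj_mk hp]

end DirectedUnions

/-! ### Small intersections of subobjects -/

section SmallIntersections

variable {C : Type u} [Category.{v} C]

theorem mk_factors_iff_exists {T X U : C} (m : X ⟶ U) [Mono m] (f : T ⟶ U) :
    (Subobject.mk m).Factors f ↔ ∃ g : T ⟶ X, g ≫ m = f :=
  Subobject.mk_factors_iff m f

theorem coconePointwiseProduct_ι_app {ι : Type*} [HasProductsOfShape ι C] {J : ι → Type*}
    [∀ i, Category* (J i)] {F : ∀ i, J i ⥤ C} (c : ∀ i, Cocone (F i)) (φ : ∀ i, J i) :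
    (coconePointwiseProduct c).ι.app φ = Limits.Pi.map fun i => (c i).ι.app (φ i) :=
  Category.comp_id _

theorem coconePointwiseProduct_ι_app_comp {ι : Type*} [HasProductsOfShape ι C] {J : ι → Type*}
    [∀ i, Category* (J i)] {F : ∀ i, J i ⥤ C} (c : ∀ i, Cocone (F i)) (φ : ∀ i, J i)
    {Y : ι → C} {m : ∀ i, (c i).pt ⟶ Y i} {a : ∀ i, (F i).obj (φ i) ⟶ Y i}
    (h : ∀ i, (c i).ι.app (φ i) ≫ m i = a i) :
    (coconePointwiseProduct c).ι.app φ ≫ Limits.Pi.map m = Limits.Pi.map a := by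
  obtain rfl : (fun i => (c i).ι.app (φ i) ≫ m i) = a := funext h
  rw [coconePointwiseProduct_ι_app]
  exact Limits.Pi.map_comp_map _ _

variable [HasLimitsOfSize.{v, v} C]

/-- The intersection of a small family of subobjects: the pullback along the diagonal of the
product of the inclusions. -/
noncomputable def smallInf {ι : Type v} {U : C} (A : ι → Subobject U) : Subobject U :=
  (Subobject.pullback (Pi.lift fun _ : ι => 𝟙 U)).obj
    (Subobject.mk (Limits.Pi.map fun i => (A i).arrow))

theorem smallInf_factors_iff {ι : Type v} {U : C} (A : ι → Subobject U) {T : C} (f : T ⟶ U) :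
    (smallInf A).Factors f ↔ ∀ i, (A i).Factors f := by
  rw [smallInf, pullback_factors_iff, mk_factors_iff_exists]
  constructor
  · rintro ⟨g, hg⟩ i
    have := congrArg (· ≫ Pi.π (fun _ => U) i) hg
    simp only [Category.assoc, Pi.map_π, Pi.lift_π, Category.comp_id] at this
    rw [← this, ← Category.assoc]
    exact Subobject.factors_comp_arrow _
  · intro h
    exact ⟨Pi.lift fun i => (A i).factorThru f (h i), Pi.hom_ext _ _ fun i => by simp⟩

theorem le_smallInf_iff {ι : Type v} {U : C} {A : ι → Subobject U} {B : Subobject U} :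
    B ≤ smallInf A ↔ ∀ i, B ≤ A i := by
  have key : ∀ D : Subobject U, B ≤ D ↔ D.Factors B.arrow := fun D =>
    ⟨fun h => Subobject.factors_of_le _ h (Subobject.factors_self _), Subobject.le_of_factors⟩
  simp only [key, smallInf_factors_iff]

theorem smallInf_le {ι : Type v} {U : C} (A : ι → Subobject U) (i : ι) : smallInf A ≤ A i :=
  le_smallInf_iff.1 le_rfl i

theorem smallInf_mono {ι : Type v} {U : C} {A B : ι → Subobject U} (h : ∀ i, A i ≤ B i) :
    smallInf A ≤ smallInf B :=
  le_smallInf_iff.2 fun i => (smallInf_le A i).trans (h i)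

theorem directed_smallInf {ι : Type v} {J : ι → Type v} {U : C} {A : ∀ i, J i → Subobject U}
    (hA : ∀ i, Directed (· ≤ ·) (A i)) :
    Directed (· ≤ ·) fun φ : ∀ i, J i => smallInf fun i => A i (φ i) := by
  intro φ ψ
  choose χ h₁ h₂ using fun i => hA i (φ i) (ψ i)
  exact ⟨χ, smallInf_mono h₁, smallInf_mono h₂⟩

/-- Small intersections of subobjects distribute over directed unions. -/
theorem isLUB_smallInf [HasSiftedColimits C] (hC : FiniteLimitsCommuteWithFilteredColimits C)
    (hD : FilteredColimitsDistributeOverProducts C) {ι : Type v} {J : ι → Type v}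
    [∀ i, Nonempty (J i)] {U : C} {A : ∀ i, J i → Subobject U}
    (hA : ∀ i, Directed (· ≤ ·) (A i)) {B : ι → Subobject U}
    (hB : ∀ i, IsLUB (Set.range (A i)) (B i)) :
    IsLUB (Set.range fun φ : ∀ i, J i => smallInf fun i => A i (φ i)) (smallInf B) := by
  let (i : ι) : Preorder (J i) := Preorder.lift (A i)
  have (i : ι) : IsDirectedOrder (J i) := isDirectedOrder_lift (hA i)
  have hA' : ∀ i, Monotone (A i) := fun i _ _ h => h
  have hle : ∀ i k, A i k ≤ B i := fun i k => (hB i).1 ⟨k, rfl⟩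
  obtain ⟨hc⟩ := hD ι J (fun i => underlyingDiagram (hA' i))
    (fun i => underlyingCocone (hA' i) (hle i)) fun i => isColimit_of_isLUB hC (hA' i) (hB i) _
  have key : IsLUB
      (Set.range fun φ : ∀ i, J i => Subobject.mk (Limits.Pi.map fun i => (A i (φ i)).arrow))
      (Subobject.mk (Limits.Pi.map fun i => (B i).arrow)) := by
    let c := coconePointwiseProduct fun i => underlyingCocone (hA' i) (hle i)
    let m : c.pt ⟶ ∏ᶜ fun _ : ι => U := Limits.Pi.map fun i => (B i).arrow
    have : Mono m := inferInstanceAs (Mono (Limits.Pi.map fun i => (B i).arrow))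
    refine isLUB_mk_of_isColimit hc m
      (fun φ => Subobject.mk (Limits.Pi.map fun i => (A i (φ i)).arrow)) fun {φ T} f => ?_
    have hφ : c.ι.app φ ≫ m = Limits.Pi.map fun i => (A i (φ i)).arrow :=
      coconePointwiseProduct_ι_app_comp _ φ fun i => Subobject.ofLE_arrow (hle i (φ i))
    rw [mk_factors_iff_exists, hφ]
    rfl
  refine isLUB_pullback hC _ (fun φ ψ => ?_) key
  choose χ h₁ h₂ using fun i => hA i (φ i) (ψ i)
  exact ⟨χ, Subobject.mk_le_mk_of_comm (Limits.Pi.map fun i => (A i _).ofLE _ (h₁ i))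
      (Pi.hom_ext _ _ fun i => by simp),
    Subobject.mk_le_mk_of_comm (Limits.Pi.map fun i => (A i _).ofLE _ (h₂ i))
      (Pi.hom_ext _ _ fun i => by simp)⟩

end SmallIntersections

/-! ### Covering sieves -/

section Covers

variable {C : Type u} [Category.{v} C]

/-- A sieve meets a subobject `A` of `U` if it contains a morphism whose image is `A`. -/
def Hits {U : C} (S : Sieve U) (A : Subobject U) : Prop :=
  ∃ (V : C) (e : V ⟶ (A : C)), IsRegularEpi e ∧ S (e ≫ A.arrow)

/-- A sieve on `U` covers if `U` is a small directed union of images of morphisms of the sieve. -/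
def Covers {U : C} (S : Sieve U) : Prop :=
  ∃ (K : Type v) (_ : Nonempty K) (A : K → Subobject U),
    Directed (· ≤ ·) A ∧ IsLUB (Set.range A) ⊤ ∧ ∀ k, Hits S (A k)

theorem covers_top (U : C) : Covers (⊤ : Sieve U) :=
  ⟨PUnit, inferInstance, fun _ => ⊤, fun _ _ => ⟨⟨⟩, le_rfl, le_rfl⟩, by simp,
    fun _ => ⟨_, 𝟙 _, inferInstance, trivial⟩⟩

theorem Covers.mono {U : C} {S R : Sieve U} (hS : Covers S) (h : S ≤ R) : Covers R := by
  obtain ⟨K, hK, A, hA, hA', H⟩ := hS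
  refine ⟨K, hK, A, hA, hA', fun k => ?_⟩
  obtain ⟨V, e, he, he'⟩ := H k
  exact ⟨V, e, he, h _ he'⟩

variable [Regular C]

theorem isRegularEpi_comp {X Y Z : C} (f : X ⟶ Y) (g : Y ⟶ Z) [IsRegularEpi f] [IsRegularEpi g] :
    IsRegularEpi (f ≫ g) := by
  have : StrongEpi (f ≫ g) := strongEpi_comp f g
  infer_instance

/-- A containment of subobjects can be checked after covering the smaller one by a regular
epimorphism, since regular epimorphisms are extremal. -/
theorem Subobject.le_of_isRegularEpi {U V : C} {A D : Subobject U} (e : V ⟶ (A : C))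
    [IsRegularEpi e] (h : D.Factors (e ≫ A.arrow)) : A ≤ D := by
  have h₁ : ((Subobject.pullback A.arrow).obj D).Factors e := pullback_factors _ _ _ h
  have h₂ := ExtremalEpi.subobject_eq_top e h₁
  apply Subobject.le_of_factors
  have h₃ : ((Subobject.pullback A.arrow).obj D).Factors (𝟙 _) := by
    rw [h₂]
    exact Subobject.top_factors _
  simpa using (pullback_factors_iff _ _ _).1 h₃

theorem Hits.mono {U : C} {S : Sieve U} {A B : Subobject U} (hA : Hits S A) (h : B ≤ A) :
    Hits S B := by
  obtain ⟨V, e, he, he'⟩ := hA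
  refine ⟨_, pullback.snd e (B.ofLE A h), inferInstance, ?_⟩
  have : pullback.snd e (B.ofLE A h) ≫ B.arrow = pullback.fst e (B.ofLE A h) ≫ e ≫ A.arrow := by
    rw [pullback.condition_assoc, Subobject.ofLE_arrow]
  rw [this]
  exact S.downward_closed he' _

theorem Hits.pullback {U V : C} {S : Sieve U} {A : Subobject U} (hA : Hits S A) (f : V ⟶ U) :
    Hits (S.pullback f) ((Subobject.pullback f).obj A) := by
  obtain ⟨W, e, he, he'⟩ := hA
  refine ⟨_, pullback.snd e (Subobject.pullbackπ f A), inferInstance, ?_⟩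
  have : (pullback.snd e (Subobject.pullbackπ f A) ≫ ((Subobject.pullback f).obj A).arrow) ≫ f =
      pullback.fst e (Subobject.pullbackπ f A) ≫ e ≫ A.arrow := by
    rw [pullback.condition_assoc, Category.assoc, (Subobject.isPullback f A).w]
  rw [Sieve.pullback_apply, this]
  exact S.downward_closed he' _

/-- Covering sieves are stable under pullback, because images and directed unions are. -/
theorem Covers.pullback [HasSiftedColimits C] (hC : FiniteLimitsCommuteWithFilteredColimits C)
    {U V : C} {S : Sieve U} (hS : Covers S) (f : V ⟶ U) : Covers (S.pullback f) := by
  obtain ⟨K, hK, A, hA, hA', H⟩ := hS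
  refine ⟨K, hK, _, ?_, ?_, fun k => (H k).pullback f⟩
  · exact hA.mono_comp _ (Subobject.pullback f).monotone
  · rw [← Subobject.pullback_top f]
    exact isLUB_pullback hC f hA hA'

variable [HasLimitsOfSize.{v, v} C]

/-- If the sieves `S i` contain morphisms `e i` with images `A i`, then the intersection of the
sieves contains the pullback of the product of the `e i`, whose image is the intersection
of the `A i`. -/
theorem Hits.iInf (hP : RegularEpisStableUnderProducts C) {ι : Type v} {U : C} {S : ι → Sieve U}
    {A : ι → Subobject U} (hA : ∀ i, Hits (S i) (A i)) : Hits (⨅ i, S i) (smallInf A) := by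
  choose V e he he' using hA
  have := hP ι _ _ e he
  let q : (smallInf A : C) ⟶ ∏ᶜ fun i => (A i : C) :=
    Pi.lift fun i => (smallInf A).ofLE _ (smallInf_le A i)
  refine ⟨_, pullback.snd (Limits.Pi.map e) q, inferInstance, ?_⟩
  rintro _ ⟨i, rfl⟩
  have : pullback.snd (Limits.Pi.map e) q ≫ (smallInf A).arrow =
      (pullback.fst (Limits.Pi.map e) q ≫ Pi.π _ i) ≫ e i ≫ (A i).arrow := by
    have h₁ : (smallInf A).arrow = (q ≫ Pi.π _ i) ≫ (A i).arrow := by simp [q]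
    rw [h₁, Category.assoc, Category.assoc, ← pullback.condition_assoc]
    simp
  rw [this]
  exact (S i).downward_closed (he' i) _

variable [HasSiftedColimits C]

/-- Small intersections of covering sieves cover. -/
theorem Covers.iInf (hC : FiniteLimitsCommuteWithFilteredColimits C)
    (hP : RegularEpisStableUnderProducts C) (hD : FilteredColimitsDistributeOverProducts C)
    {ι : Type v} {U : C} {S : ι → Sieve U} (hS : ∀ i, Covers (S i)) : Covers (⨅ i, S i) := by
  choose K hK A hA hA' H using hS
  refine ⟨∀ i, K i, inferInstance, fun φ => smallInf fun i => A i (φ i), directed_smallInf hA, ?_,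
    fun φ => Hits.iInf hP fun i => H i (φ i)⟩
  have := isLUB_smallInf hC hD hA hA'
  rwa [show smallInf (fun _ : ι => (⊤ : Subobject U)) = ⊤ from
    top_le_iff.1 (le_smallInf_iff.2 fun _ => le_rfl)] at this

/-- A sieve meeting the members of directed unions whose values form a directed union equal to `U`
covers. The unions cannot be concatenated as they stand; distributivity makes it possible to
replace the members of the union of index `k` by intersections of members over all the indices
above `k`, which are directed as `k` varies. -/
theorem covers_of_isLUB (hC : FiniteLimitsCommuteWithFilteredColimits C)
    (hD : FilteredColimitsDistributeOverProducts C) {U : C} {S : Sieve U} {K : Type v} [Nonempty K]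
    {A : K → Subobject U} (hA : Directed (· ≤ ·) A) (hA' : IsLUB (Set.range A) ⊤)
    {J : K → Type v} [∀ k, Nonempty (J k)] {B : ∀ k, J k → Subobject U}
    (hB : ∀ k, Directed (· ≤ ·) (B k)) (hB' : ∀ k, IsLUB (Set.range (B k)) (A k))
    (H : ∀ k j, Hits S (B k j)) : Covers S := by
  let D : K × (∀ k, J k) → Subobject U := fun p =>
    smallInf fun l : { l // A p.1 ≤ A l } => B l (p.2 l)
  refine ⟨K × (∀ k, J k), inferInstance, D, ?_, ?_, ?_⟩
  · rintro ⟨k, φ⟩ ⟨k', φ'⟩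
    obtain ⟨m, h₁, h₂⟩ := hA k k'
    choose χ h₃ h₄ using fun l => hB l (φ l) (φ' l)
    exact ⟨(m, χ),
      le_smallInf_iff.2 fun l => (smallInf_le _ (⟨l.1, h₁.trans l.2⟩ : { l // A k ≤ A l })).trans
        (h₃ l),
      le_smallInf_iff.2 fun l => (smallInf_le _ (⟨l.1, h₂.trans l.2⟩ : { l // A k' ≤ A l })).trans
        (h₄ l)⟩
  · refine ⟨fun _ _ => le_top, fun X hX => hA'.2 ?_⟩
    rintro _ ⟨k, rfl⟩
    have hk := isLUB_smallInf hC hD (fun l : { l // A k ≤ A l } => hB l) fun l => hB' l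
    refine (le_smallInf_iff.2 fun l : { l // A k ≤ A l } => l.2).trans (hk.2 ?_)
    rintro _ ⟨ψ, rfl⟩
    classical
    let φ : ∀ l, J l := fun l => if h : A k ≤ A l then ψ ⟨l, h⟩ else Classical.arbitrary _
    have : D (k, φ) = smallInf fun l : { l // A k ≤ A l } => B l (ψ l) :=
      congrArg smallInf (funext fun l => by simp [φ, l.2])
    exact this.ge.trans (hX ⟨(k, φ), rfl⟩)
  · rintro ⟨k, φ⟩
    exact (H k (φ k)).mono (smallInf_le _ (⟨k, le_rfl⟩ : { l // A k ≤ A l }))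

/-- Transitivity of covers. If `e k` is the morphism with image `A k`, the directed unions covering
its source are carried by `e k` to directed unions in `U` with values `A k`, so that
`covers_of_isLUB` applies. -/
theorem Covers.trans (hC : FiniteLimitsCommuteWithFilteredColimits C)
    (hD : FilteredColimitsDistributeOverProducts C) {U : C} {S R : Sieve U} (hS : Covers S)
    (hR : ∀ ⦃V : C⦄ (f : V ⟶ U), S f → Covers (R.pullback f)) : Covers R := by
  obtain ⟨K, hK, A, hA, hA', H⟩ := hS
  choose V e he he' using H
  choose J hJ B hB hB' H' using fun k => hR _ (he' k)
  refine covers_of_isLUB hC hD hA hA' (J := J)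
    (B := fun k j => imageSubobject ((B k j).arrow ≫ e k ≫ (A k).arrow)) (fun k => ?_)
    (fun k => ⟨?_, fun X hX => ?_⟩) fun k j => ?_
  · intro j j'
    obtain ⟨j'', h₁, h₂⟩ := hB k j j'
    have key : ∀ i (h : B k i ≤ B k j''),
        imageSubobject ((B k i).arrow ≫ e k ≫ (A k).arrow) ≤
          imageSubobject ((B k j'').arrow ≫ e k ≫ (A k).arrow) := fun i h =>
      imageSubobject_le _ ((B k i).ofLE _ h ≫ factorThruImageSubobject _) (by simp)
    exact ⟨j'', key _ h₁, key _ h₂⟩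
  · rintro _ ⟨j, rfl⟩
    exact imageSubobject_le _ ((B k j).arrow ≫ e k) (by simp)
  · refine Subobject.le_of_isRegularEpi (e k) ?_
    rw [← Category.id_comp (e k ≫ _), ← pullback_factors_iff]
    have : (⊤ : Subobject (V k)) ≤ (Subobject.pullback (e k ≫ (A k).arrow)).obj X := by
      refine (hB' k).2 ?_
      rintro _ ⟨j, rfl⟩
      apply Subobject.le_of_factors
      rw [pullback_factors_iff, ← imageSubobject_arrow_comp ((B k j).arrow ≫ e k ≫ (A k).arrow)]
      exact Subobject.factors_of_le _ (hX ⟨j, rfl⟩) (Subobject.factors_comp_arrow _)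
    exact Subobject.factors_of_le _ this (Subobject.top_factors _)
  · obtain ⟨W, a, ha, ha'⟩ := H' k j
    refine ⟨W, a ≫ factorThruImageSubobject _, ?_, ?_⟩
    · have : IsRegularEpi (factorThruImageSubobject ((B k j).arrow ≫ e k ≫ (A k).arrow)) := by
        have : StrongEpi (factorThruImageSubobject ((B k j).arrow ≫ e k ≫ (A k).arrow)) := by
          unfold factorThruImageSubobject
          infer_instance
        infer_instance
      exact isRegularEpi_comp _ _
    · simpa using ha'

end Covers

/-! ### The Grothendieck topology and its subcanonicity -/

section Topology

variable (C : Type u) [Category.{v} C] [HasLimitsOfSize.{v, v} C] [HasSiftedColimits C]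

/-- The four exactness conditions characterising algebraic exactness. -/
structure ExactnessConditions : Prop where
  isBarrExact : IsBarrExact C
  finiteLimits : FiniteLimitsCommuteWithFilteredColimits C
  regularEpis : RegularEpisStableUnderProducts C
  distributive : FilteredColimitsDistributeOverProducts C

namespace ExactnessConditions

variable {C}

theorem regular (h : ExactnessConditions C) : Regular C := h.isBarrExact.regular

/-- The Grothendieck topology of sieves on `U` containing a family of morphisms whose images form a
small directed union equal to `U`. -/
def topology (h : ExactnessConditions C) : GrothendieckTopology C :=
  have := h.regular
  { sieves := fun _ => { S | Covers S }
    top_mem' := covers_top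
    pullback_stable' := fun _ _ _ f hS => Covers.pullback h.finiteLimits hS f
    transitive' := fun _ _ hS _ hR =>
      Covers.trans h.finiteLimits h.distributive hS fun _ _ hf => hR hf }

variable (h : ExactnessConditions C)

theorem iInf_mem {ι : Type v} {U : C} {S : ι → Sieve U} (hS : ∀ i, S i ∈ h.topology U) :
    ⨅ i, S i ∈ h.topology U :=
  have := h.regular
  Covers.iInf h.finiteLimits h.regularEpis h.distributive hS

/-- The representable presheaves are separated. -/
theorem hom_ext {U Y : C} {S : Sieve U} (hS : S ∈ h.topology U) {s t : U ⟶ Y}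
    (hst : ∀ ⦃V : C⦄ (f : V ⟶ U), S f → f ≫ s = f ≫ t) : s = t := by
  have := h.regular
  obtain ⟨K, _, A, -, hA, H⟩ := hS
  have : (⊤ : Subobject U) ≤ equalizerSubobject s t := by
    refine hA.2 ?_
    rintro _ ⟨k, rfl⟩
    obtain ⟨V, e, he, he'⟩ := H k
    apply Subobject.le_of_factors
    rw [equalizerSubobject_factors_iff, ← cancel_epi e]
    simpa using hst _ he'
  simpa using (equalizerSubobject_factors_iff s t (𝟙 U)).1
    (Subobject.factors_of_le _ this (Subobject.top_factors _))

/-- The representable presheaves are sheaves: compatible morphisms descend to the images by the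
universal property of regular epimorphisms, and then to their directed union, which is a colimit. -/
theorem exists_glue {U Y : C} {S : Sieve U} (hS : S ∈ h.topology U)
    (x : ∀ ⦃V : C⦄ (f : V ⟶ U), S f → (V ⟶ Y))
    (hx : ∀ ⦃V W : C⦄ (g : W ⟶ V) (f : V ⟶ U) (hf : S f) (hgf : S (g ≫ f)),
      x (g ≫ f) hgf = g ≫ x f hf) :
    ∃ t : U ⟶ Y, ∀ ⦃V : C⦄ (f : V ⟶ U) (hf : S f), f ≫ t = x f hf := by
  have := h.regular
  have hx' : ∀ ⦃V W W' : C⦄ (g : W ⟶ V) (f : V ⟶ U) (g' : W ⟶ W') (f' : W' ⟶ U) (hf : S f)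
      (hf' : S f'), g ≫ f = g' ≫ f' → g ≫ x f hf = g' ≫ x f' hf' := by
    intro V W W' g f g' f' hf hf' e
    rw [← hx g f hf (S.downward_closed hf g), ← hx g' f' hf' (S.downward_closed hf' g')]
    congr 1
  obtain ⟨K, _, A, hA, hA', H⟩ := id hS
  choose V e he he' using H
  -- the value on `A k` is obtained by descent along the regular epimorphism `e k`
  have hy : ∀ k, ∃ y : (A k : C) ⟶ Y, e k ≫ y = x _ (he' k) := fun k =>
    ⟨IsRegularEpi.desc (e k) (x _ (he' k))
      (hx' _ _ _ _ _ _ (by simp [← Category.assoc, IsRegularEpi.w])), IsRegularEpi.fac _ _ _⟩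
  choose y hy using hy
  have hyc : ∀ k l (hkl : A k ≤ A l), (A k).ofLE _ hkl ≫ y l = y k := by
    intro k l hkl
    have hp := pullback.condition (f := e k ≫ (A k).ofLE _ hkl) (g := e l)
    rw [← cancel_epi (e k), ← cancel_epi (pullback.fst (e k ≫ (A k).ofLE _ hkl) (e l)), hy,
      ← Category.assoc (e k), ← Category.assoc, hp, Category.assoc, hy]
    refine hx' _ _ _ _ _ _ ?_
    rw [← Category.assoc, ← hp]
    simp
  let := Preorder.lift A
  have := isDirectedOrder_lift hA
  obtain ⟨hc⟩ := isColimit_of_isLUB h.finiteLimits (A := A) (fun _ _ h => h) hA' fun _ => le_top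
  let s : Cocone (underlyingDiagram (A := A) fun _ _ h => h) :=
    { pt := Y
      ι :=
        { app := fun k => y k
          naturality := fun k l f => by simpa using hyc k l f.le } }
  obtain ⟨t, ht⟩ : ∃ t : ((⊤ : Subobject U) : C) ⟶ Y, ∀ k, (A k).ofLE ⊤ le_top ≫ t = y k :=
    ⟨hc.desc s, fun k => hc.fac s k⟩
  refine ⟨inv (⊤ : Subobject U).arrow ≫ t, ?_⟩
  have hT : ∀ k, e k ≫ (A k).arrow ≫ inv (⊤ : Subobject U).arrow ≫ t = x _ (he' k) := by
    intro k
    have : (A k).arrow ≫ inv (⊤ : Subobject U).arrow = (A k).ofLE ⊤ le_top := by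
      rw [IsIso.comp_inv_eq, Subobject.ofLE_arrow]
    rw [← hy, ← ht, reassoc_of% this]
  -- the morphisms on which `t` restricts correctly form a covering sieve
  let T : Sieve U :=
    { arrows := fun V f => ∃ hf : S f, f ≫ inv (⊤ : Subobject U).arrow ≫ t = x f hf
      downward_closed := by
        rintro V W f ⟨hf, hf'⟩ g
        exact ⟨S.downward_closed hf g, by rw [hx g f hf, Category.assoc, hf']⟩ }
  have hT' : T ∈ h.topology U :=
    ⟨K, inferInstance, A, hA, hA', fun k => ⟨V k, e k, he k, he' k, by simpa using hT k⟩⟩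
  intro W f hf
  refine h.hom_ext (h.topology.pullback_stable f hT') fun W' g hg => ?_
  obtain ⟨hg₁, hg₂⟩ := hg
  rw [← hx g f hf hg₁, ← hg₂, Category.assoc]

end ExactnessConditions

end Topology

/-! ### Reflections and locally bijective morphisms -/

section Reflections

variable {C : Type u} [Category.{v} C]

/-- A morphism from a presheaf `F` to a representable presheaf is a reflection if every morphism
from `F` to a representable presheaf factors uniquely through it. -/
def IsReflection {F : Cᵒᵖ ⥤ Type v} {X : C} (φ : F ⟶ yoneda.obj X) : Prop :=
  ∀ (Y : C) (g : F ⟶ yoneda.obj Y), ∃! f : X ⟶ Y, φ ≫ yoneda.map f = g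

/-- A morphism of presheaves is locally bijective if it is locally injective and locally
surjective. -/
structure IsLocallyBijective (J : GrothendieckTopology C) {F G : Cᵒᵖ ⥤ Type v} (φ : F ⟶ G) :
    Prop where
  inj : Presheaf.IsLocallyInjective J φ
  surj : Presheaf.IsLocallySurjective J φ

theorem IsLocallyBijective.of_isIso (J : GrothendieckTopology C) {F G : Cᵒᵖ ⥤ Type v} (φ : F ⟶ G)
    [IsIso φ] : IsLocallyBijective J φ :=
  ⟨inferInstance, inferInstance⟩

theorem IsLocallyBijective.comp {J : GrothendieckTopology C} {F G H : Cᵒᵖ ⥤ Type v} {φ : F ⟶ G}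
    {ψ : G ⟶ H} (hφ : IsLocallyBijective J φ) (hψ : IsLocallyBijective J ψ) :
    IsLocallyBijective J (φ ≫ ψ) :=
  have := hφ.inj
  have := hφ.surj
  have := hψ.inj
  have := hψ.surj
  ⟨inferInstance, inferInstance⟩

/-- A compatible family of morphisms `p i : P ⟶ F i` exhibits `P` as the limit of `F` sectionwise:
the sections of `P` over each object correspond to compatible families of sections of `F`. -/
structure IsSectionwiseLimit {I : Type v} [SmallCategory I] {F : I ⥤ Cᵒᵖ ⥤ Type v}
    {P : Cᵒᵖ ⥤ Type v} (p : ∀ i, P ⟶ F.obj i) : Prop where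
  w : ∀ {i j} (a : i ⟶ j), p i ≫ F.map a = p j
  ext {U : Cᵒᵖ} {s t : P.obj U} : (∀ i, (p i).app U s = (p i).app U t) → s = t
  exists_lift : ∀ {U : Cᵒᵖ} (x : ∀ i, (F.obj i).obj U),
    (∀ {i j} (a : i ⟶ j), (F.map a).app U (x i) = x j) → ∃ s : P.obj U, ∀ i, (p i).app U s = x i

theorem isSectionwiseLimit_of_isLimit {I : Type v} [SmallCategory I] {F : I ⥤ Cᵒᵖ ⥤ Type v}
    {c : Cone F} (hc : IsLimit c) : IsSectionwiseLimit (F := F) (P := c.pt) c.π.app where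
  w a := c.w a
  ext {U _ _} hst :=
    Concrete.isLimit_ext _ (isLimitOfPreserves ((evaluation _ _).obj U) hc) _ _ hst
  exists_lift {U} x hx :=
    ⟨(Types.isLimitEquivSections (isLimitOfPreserves ((evaluation _ _).obj U) hc)).symm
      ⟨x, fun f => hx f⟩, fun i => Types.isLimitEquivSections_symm_apply
        (isLimitOfPreserves ((evaluation _ _).obj U) hc) ⟨x, fun f => hx f⟩ i⟩

variable [HasLimitsOfSize.{v, v} C] [HasSiftedColimits C]

/-- A locally bijective morphism to a representable presheaf is a reflection, because representable
presheaves are sheaves. -/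
theorem ExactnessConditions.isReflection (h : ExactnessConditions C) {F : Cᵒᵖ ⥤ Type v} {X : C}
    {φ : F ⟶ yoneda.obj X} (hφ : IsLocallyBijective h.topology φ) : IsReflection φ := by
  intro Y g
  have := hφ.inj
  have := hφ.surj
  have hS := Presheaf.imageSieve_mem h.topology φ (U := Opposite.op X) (𝟙 X)
  -- `g` factors through `φ` on sections, since the target of `g` is separated
  have hwd : ∀ {V : C} (s s' : F.obj (Opposite.op V)), φ.app _ s = φ.app _ s' →
      g.app _ s = g.app _ s' := by
    intro V s s' hs
    refine h.hom_ext (Presheaf.equalizerSieve_mem h.topology φ s s' hs) fun W f hf => ?_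
    have h₁ := NatTrans.naturality_apply g f.op s
    have h₂ := NatTrans.naturality_apply g f.op s'
    dsimp at h₁ h₂ hf
    rw [← h₁, ← h₂, hf]
  choose p hp using fun (V : C) (f : V ⟶ X) (hf : Presheaf.imageSieve φ (𝟙 X) f) => hf
  have hp' : ∀ {V : C} (f : V ⟶ X) (hf : Presheaf.imageSieve φ (𝟙 X) f),
      φ.app (Opposite.op V) (p V f hf) = f := fun f hf => (hp _ f hf).trans (Category.comp_id f)
  obtain ⟨t, ht⟩ := h.exists_glue hS (fun V f hf => g.app (Opposite.op V) (p V f hf)) (by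
    intro V W a f hf haf
    have h₁ := NatTrans.naturality_apply g a.op (p V f hf)
    have h₂ := NatTrans.naturality_apply φ a.op (p V f hf)
    rw [hp' f hf] at h₂
    dsimp at h₁ h₂ ⊢
    rw [← h₁]
    exact hwd _ _ ((hp' _ haf).trans h₂.symm))
  refine ⟨t, ?_, fun t' ht' => h.hom_ext hS fun V f hf => ?_⟩
  · ext V s
    have hs : Presheaf.imageSieve φ (𝟙 X) (φ.app V s) := ⟨s, (Category.comp_id _).symm⟩
    exact (ht _ hs).trans (hwd _ _ (hp' _ hs))
  · rw [ht f hf]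
    dsimp only at ht'
    have := ConcreteCategory.congr_hom (NatTrans.congr_app ht' (Opposite.op V)) (p V f hf)
    rw [← this]
    exact congrArg (· ≫ t') (hp' f hf).symm

/-- Small limits of locally bijective morphisms are locally bijective, because small intersections
of covering sieves cover. -/
theorem ExactnessConditions.isLocallyBijective_limit (h : ExactnessConditions C) {I : Type v}
    [SmallCategory I] {F G : I ⥤ Cᵒᵖ ⥤ Type v} (φ : F ⟶ G)
    (hφ : ∀ i, IsLocallyBijective h.topology (φ.app i)) {P Q : Cᵒᵖ ⥤ Type v}
    {p : ∀ i, P ⟶ F.obj i} (hp : IsSectionwiseLimit p) {q : ∀ i, Q ⟶ G.obj i}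
    (hq : IsSectionwiseLimit q) (m : P ⟶ Q) (hm : ∀ i, m ≫ q i = p i ≫ φ.app i) :
    IsLocallyBijective h.topology m := by
  have hinj := fun i => (hφ i).inj
  have hsurj := fun i => (hφ i).surj
  have hm' : ∀ i {U} (s : P.obj U), (q i).app U (m.app U s) = (φ.app i).app U ((p i).app U s) :=
    fun i U s => ConcreteCategory.congr_hom (NatTrans.congr_app (hm i) U) s
  constructor
  · constructor
    intro U s t hst
    have := h.iInf_mem (U := U.unop) fun i => Presheaf.equalizerSieve_mem h.topology (φ.app i)
      ((p i).app U s) ((p i).app U t) (by rw [← hm', ← hm', hst])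
    refine h.topology.superset_covering (fun V f hf => ?_) this
    refine hp.ext fun i => ?_
    have hfi := hf _ ⟨i, rfl⟩
    rw [NatTrans.naturality_apply, NatTrans.naturality_apply]
    exact hfi
  · constructor
    intro U x
    have := h.iInf_mem (U := U) fun i => Presheaf.imageSieve_mem h.topology (φ.app i)
      (U := Opposite.op U) ((q i).app _ x)
    refine h.topology.transitive this _ fun V f hf => ?_
    have hf' : ∀ i, ∃ s : (F.obj i).obj (Opposite.op V), (φ.app i).app _ s =
      (q i).app _ (Q.map f.op x) := fun i => by
        obtain ⟨s, hs⟩ := hf _ ⟨i, rfl⟩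
        exact ⟨s, hs.trans (NatTrans.naturality_apply (q i) f.op x).symm⟩
    choose s hs using hf'
    -- the chosen local preimages are compatible locally
    have := h.iInf_mem (U := V) fun a : (Σ p : I × I, p.1 ⟶ p.2) =>
      Presheaf.equalizerSieve_mem h.topology (X := Opposite.op V) (φ.app a.1.2)
        ((F.map a.2).app _ (s a.1.1)) (s a.1.2) (by
          have h₁ := ConcreteCategory.congr_hom (NatTrans.congr_app (φ.naturality a.2)
            (Opposite.op V)) (s a.1.1)
          have h₂ := ConcreteCategory.congr_hom (NatTrans.congr_app (hq.w a.2) (Opposite.op V))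
            (Q.map f.op x)
          dsimp at h₁ h₂
          rw [h₁, hs, hs, h₂])
    refine h.topology.superset_covering (fun W g hg => ?_) this
    obtain ⟨t, ht⟩ := hp.exists_lift (U := Opposite.op W) (fun i => (F.obj i).map g.op (s i))
      (fun {i j} a => by
        have := hg _ ⟨⟨(i, j), a⟩, rfl⟩
        rw [NatTrans.naturality_apply]
        exact this)
    refine ⟨t, hq.ext fun i => ?_⟩
    rw [hm', ht, NatTrans.naturality_apply, hs, ← NatTrans.naturality_apply]
    simp

end Reflections

/-! ### Zigzags in sifted categories -/

section Zigzags

/-- Finite zigzags of morphisms starting at `k`. -/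
inductive ZigzagPath {K : Type v} [SmallCategory K] (k : K) : K → Type v
  | nil : ZigzagPath k k
  | forward {l m : K} (p : ZigzagPath k l) (f : l ⟶ m) : ZigzagPath k m
  | backward {l m : K} (p : ZigzagPath k l) (f : m ⟶ l) : ZigzagPath k m

variable {K : Type v} [SmallCategory K]

/-- A zigzag relates elements of the values of `G` at its ends if it lifts to a zigzag of elements
of `G` between them. -/
def ZigzagPath.Connects (G : K ⥤ Type v) {k : K} :
    ∀ {l : K}, ZigzagPath k l → G.obj k → G.obj l → Prop
  | _, .nil, x, y => x = y
  | _, .forward p f, x, y => ∃ z, p.Connects G x z ∧ G.map f z = y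
  | _, .backward p f, x, y => p.Connects G x (G.map f y)

theorem ZigzagPath.Connects.map {G G' : K ⥤ Type v} (α : G ⟶ G') {k l : K} (p : ZigzagPath k l)
    {x : G.obj k} {y : G.obj l} (h : p.Connects G x y) :
    p.Connects G' (α.app k x) (α.app l y) := by
  induction p with
  | nil => exact congrArg (α.app k) h
  | forward p f ih =>
    obtain ⟨z, hz, rfl⟩ := h
    exact ⟨_, ih hz, (NatTrans.naturality_apply α f z).symm⟩
  | backward p f ih =>
    have := ih h
    rw [NatTrans.naturality_apply] at this
    exact this

theorem ZigzagPath.Connects.ι_eq {G : K ⥤ Type v} (c : Cocone G) {k l : K} {p : ZigzagPath k l}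
    {x : G.obj k} {y : G.obj l} (h : p.Connects G x y) : c.ι.app k x = c.ι.app l y := by
  induction p with
  | nil => exact congrArg (c.ι.app k) h
  | forward p f ih =>
    obtain ⟨z, hz, rfl⟩ := h
    rw [ih hz]
    exact (ConcreteCategory.congr_hom (c.w f) z).symm
  | backward p f ih => exact (ih h).trans (ConcreteCategory.congr_hom (c.w f) y)

/-- To transport a property of elements of `G` between elements with equal images in the colimit,
it suffices that it is invariant under the action of `G`. -/
theorem iff_of_ι_eq {G : K ⥤ Type v} {c : Cocone G} (hc : IsColimit c) (Q : ∀ l, G.obj l → Prop)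
    (hQ : ∀ {l m : K} (f : l ⟶ m) (y : G.obj l), Q m (G.map f y) ↔ Q l y) {k l : K}
    {x : G.obj k} {y : G.obj l} (h : c.ι.app k x = c.ι.app l y) : Q k x ↔ Q l y := by
  let s : Cocone G :=
    { pt := ULift.{v} Prop
      ι :=
        { app := fun l => ↾fun y => ULift.up (Q l y)
          naturality := fun l m f => by
            ext y
            exact congrArg ULift.up (propext (hQ f y)) } }
  have h₁ : s.ι.app k x = s.ι.app l y := by
    rw [← hc.fac s k, ← hc.fac s l]
    exact congrArg (hc.desc s) h
  exact iff_of_eq (congrArg ULift.down h₁)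

/-- Elements with equal images in the colimit are connected by a zigzag. -/
theorem exists_connects {G : K ⥤ Type v} {c : Cocone G} (hc : IsColimit c) {k l : K}
    {x : G.obj k} {y : G.obj l} (h : c.ι.app k x = c.ι.app l y) :
    ∃ p : ZigzagPath k l, p.Connects G x y := by
  refine (iff_of_ι_eq hc (fun m z => ∃ p : ZigzagPath k m, p.Connects G x z) ?_ h).1
    ⟨.nil, rfl⟩
  exact fun f y => ⟨fun ⟨p, hp⟩ => ⟨p.backward f, hp⟩, fun ⟨p, hp⟩ => ⟨p.forward f, y, hp, rfl⟩⟩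

open MonoidalCategory CartesianMonoidalCategory in
/-- In a sifted category, two pairs of elements that are connected by zigzags are connected by a
common zigzag. -/
theorem exists_common_connects [IsSifted K] {G G' : K ⥤ Type v} {k : K} {p p' : ZigzagPath k k}
    {x y : G.obj k} {x' y' : G'.obj k} (h : p.Connects G x y) (h' : p'.Connects G' x' y') :
    ∃ q : ZigzagPath k k, q.Connects G x y ∧ q.Connects G' x' y' := by
  -- sifted colimits of types commute with binary products
  have e : (colimit.ι (G ⊗ G') k) (x, x') = (colimit.ι (G ⊗ G') k) (y, y') := by
    have inj := (mono_iff_injective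
      (CartesianMonoidalCategory.prodComparison (colim : (K ⥤ Type v) ⥤ Type v) G G')).1
      inferInstance
    have key : ∀ z z', CartesianMonoidalCategory.prodComparison (colim : (K ⥤ Type v) ⥤ Type v) G G'
        ((colimit.ι (G ⊗ G') k) (z, z')) = (colimit.ι G k z, colimit.ι G' k z') := by
      intro z z'
      exact Prod.ext
        ((ConcreteCategory.congr_hom (CartesianMonoidalCategory.prodComparison_fst
          (colim : (K ⥤ Type v) ⥤ Type v) (A := G) (B := G')) _).trans
            (ConcreteCategory.congr_hom (ι_colimMap (fst G G') k)
              ((z, z') : G.obj k × G'.obj k)))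
        ((ConcreteCategory.congr_hom (CartesianMonoidalCategory.prodComparison_snd
          (colim : (K ⥤ Type v) ⥤ Type v) (A := G) (B := G')) _).trans
            (ConcreteCategory.congr_hom (ι_colimMap (snd G G') k)
              ((z, z') : G.obj k × G'.obj k)))
    apply inj
    rw [key, key]
    exact Prod.ext (h.ι_eq (colimit.cocone G)) (h'.ι_eq (colimit.cocone G'))
  obtain ⟨q, hq⟩ := exists_connects (colimit.isColimit (G ⊗ G')) e
  exact ⟨q, hq.map (fst G G'), hq.map (snd G G')⟩

variable {C : Type u} [Category.{v} C] [HasPullbacks C]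

/-- The pairs of morphisms into a diagram `X` connected by a given zigzag are those that factor
through a certain span, built from pullbacks. -/
theorem ZigzagPath.exists_span (X : K ⥤ C) {k l : K} (p : ZigzagPath k l) :
    ∃ (T : C) (a : T ⟶ X.obj k) (b : T ⟶ X.obj l), ∀ {U : C} (x : U ⟶ X.obj k) (y : U ⟶ X.obj l),
      p.Connects (X ⋙ coyoneda.obj (Opposite.op U)) x y ↔ ∃ g : U ⟶ T, g ≫ a = x ∧ g ≫ b = y := by
  induction p with
  | nil => exact ⟨X.obj k, 𝟙 _, 𝟙 _, fun x y =>
      ⟨fun h => ⟨x, by simp, (Category.comp_id x).trans h⟩, fun ⟨_, h, h'⟩ => h.symm.trans h'⟩⟩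
  | forward p f ih =>
    obtain ⟨T, a, b, h⟩ := ih
    refine ⟨T, a, b ≫ X.map f, fun x y => ⟨?_, ?_⟩⟩
    · rintro ⟨z, hz, rfl⟩
      obtain ⟨g, rfl, rfl⟩ := (h _ _).1 hz
      exact ⟨g, rfl, (Category.assoc _ _ _).symm⟩
    · rintro ⟨g, rfl, rfl⟩
      exact ⟨g ≫ b, (h _ _).2 ⟨g, rfl, rfl⟩, Category.assoc _ _ _⟩
  | backward p f ih =>
    obtain ⟨T, a, b, h⟩ := ih
    refine ⟨pullback b (X.map f), pullback.fst _ _ ≫ a, pullback.snd _ _, fun x y => ⟨?_, ?_⟩⟩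
    · intro hxy
      obtain ⟨g, rfl, hg⟩ := (h _ _).1 hxy
      exact ⟨pullback.lift g y hg, pullback.lift_fst_assoc _ _ _ _, pullback.lift_snd _ _ _⟩
    · rintro ⟨g, rfl, rfl⟩
      exact (h _ _).2 ⟨g ≫ pullback.fst _ _, Category.assoc _ _ _, by
        rw [Category.assoc, pullback.condition]
        exact (Category.assoc _ _ _).symm⟩

end Zigzags

/-! ### Local kernel pairs of sifted colimits of representables -/

section Sections

variable {C : Type u} [Category.{v} C]

/-- The section of `P` over `U` that a morphism `yoneda.obj X ⟶ P` assigns to a morphism `U ⟶ X`. -/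
abbrev sec {P : Cᵒᵖ ⥤ Type v} {X U : C} (ι : yoneda.obj X ⟶ P) (a : U ⟶ X) :
    P.obj (Opposite.op U) := ι.app (Opposite.op U) a

theorem sec_comp {P : Cᵒᵖ ⥤ Type v} {X U V : C} (ι : yoneda.obj X ⟶ P) (f : V ⟶ U) (a : U ⟶ X) :
    sec ι (f ≫ a) = P.map f.op (sec ι a) :=
  NatTrans.naturality_apply ι f.op a

end Sections

section LocalRepresentability

variable {C : Type u} [Category.{v} C] [HasLimitsOfSize.{v, v} C] [HasSiftedColimits C]

namespace ExactnessConditions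

variable (h : ExactnessConditions C)

/-- Subobjects are closed for the topology: a morphism factors through a subobject as soon as it
does so locally. -/
theorem factors_of_mem {U X : C} {S : Sieve U} (hS : S ∈ h.topology U) (D : Subobject X)
    (f : U ⟶ X) (hf : ∀ ⦃V : C⦄ (g : V ⟶ U), S g → D.Factors (g ≫ f)) : D.Factors f := by
  have := h.regular
  obtain ⟨K, _, A, -, hA, H⟩ := hS
  have : (⊤ : Subobject U) ≤ (Subobject.pullback f).obj D := by
    refine hA.2 ?_
    rintro _ ⟨k, rfl⟩
    obtain ⟨V, e, he, he'⟩ := H k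
    exact Subobject.le_of_isRegularEpi e ((pullback_factors_iff _ _ _).2 (hf _ he'))
  simpa using (pullback_factors_iff _ _ (𝟙 U)).1
    (Subobject.factors_of_le _ this (Subobject.top_factors _))

/-- Two sections of a presheaf over `U` are locally equal if they agree on a covering sieve. -/
def LocallyEqual {P : Cᵒᵖ ⥤ Type v} {U : C} (s t : P.obj (Opposite.op U)) : Prop :=
  Presheaf.equalizerSieve (F := P) (X := Opposite.op U) s t ∈ h.topology U

/-- Over a sifted diagram of representables, the local kernel pair of each colimit inclusion is
representable: it is the directed union of the images of the spans attached to zigzags. -/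
theorem exists_locallyEqual_iff_factors {K : Type v} [SmallCategory K] [IsSifted K] (X : K ⥤ C)
    {P : Cᵒᵖ ⥤ Type v} (ι : ∀ k, yoneda.obj (X.obj k) ⟶ P)
    (hι : ∀ {U : C} {k l : K} (a : U ⟶ X.obj k) (b : U ⟶ X.obj l), sec (ι k) a = sec (ι l) b ↔
      ∃ p : ZigzagPath k l, p.Connects (X ⋙ coyoneda.obj (Opposite.op U)) a b) (k : K) :
    ∃ S : Subobject (X.obj k ⨯ X.obj k), ∀ {U : C} (a b : U ⟶ X.obj k),
      S.Factors (prod.lift a b) ↔ h.LocallyEqual (sec (ι k) a) (sec (ι k) b) := by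
  have := h.regular
  choose T α β hT using fun p : ZigzagPath k k => p.exists_span X
  let A := fun p => imageSubobject (prod.lift (α p) (β p))
  have hα : ∀ p : ZigzagPath k k,
      p.Connects (X ⋙ coyoneda.obj (Opposite.op (T p))) (α p) (β p) := fun p =>
    (hT p _ _).2 ⟨𝟙 _, by simp, by simp⟩
  -- two zigzags are dominated by a common one, because `K` is sifted
  have hA : Directed (· ≤ ·) A := by
    intro p p'
    obtain ⟨q, hq, hq'⟩ := exists_common_connects (hα p) (hα p')
    obtain ⟨g, hg, hg'⟩ := (hT q _ _).1 hq
    obtain ⟨g', hg₁, hg₁'⟩ := (hT q _ _).1 hq'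
    refine ⟨q, imageSubobject_le _ (g ≫ factorThruImageSubobject _) ?_,
      imageSubobject_le _ (g' ≫ factorThruImageSubobject _) ?_⟩
    · rw [Category.assoc, imageSubobject_arrow_comp, prod.comp_lift, hg, hg']
    · rw [Category.assoc, imageSubobject_arrow_comp, prod.comp_lift, hg₁, hg₁']
  have : Nonempty (ZigzagPath k k) := ⟨.nil⟩
  obtain ⟨S, hS⟩ := exists_isLUB h.finiteLimits hA
  have hle : ∀ p, A p ≤ S := fun p => hS.1 ⟨p, rfl⟩
  refine ⟨S, fun {U} a b => ⟨fun hab => ?_, fun hab => ?_⟩⟩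
  · have hl := isLUB_pullback h.finiteLimits (prod.lift a b) hA hS
    have ht : (Subobject.pullback (prod.lift a b)).obj S = ⊤ := by
      refine top_le_iff.1 (Subobject.le_of_factors ?_)
      exact (pullback_factors_iff _ _ _).2 (Subobject.factors_of_factors_right _ hab)
    rw [ht] at hl
    -- the pairs identified in `P` include the span of every zigzag
    let E : Sieve (X.obj k ⨯ X.obj k) :=
      { arrows := fun V g => sec (ι k) (g ≫ prod.fst) = sec (ι k) (g ≫ prod.snd)
        downward_closed := by
          intro V W g hg f
          rw [Category.assoc, Category.assoc, sec_comp _ f, sec_comp _ f, hg] }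
    have hE : Covers (E.pullback (prod.lift a b)) := by
      refine ⟨_, inferInstance, _, hA.mono_comp _ (Subobject.pullback _).monotone, hl, fun p => ?_⟩
      refine Hits.pullback ⟨T p, factorThruImageSubobject _, ?_, ?_⟩ _
      · have : StrongEpi (factorThruImageSubobject (prod.lift (α p) (β p))) := by
          unfold factorThruImageSubobject
          infer_instance
        infer_instance
      · change sec (ι k) _ = sec (ι k) _
        rw [imageSubobject_arrow_comp, prod.lift_fst, prod.lift_snd, hι]
        exact ⟨p, hα p⟩
    refine h.topology.superset_covering (fun V f hf => ?_) hE
    have hf' : sec (ι k) ((f ≫ prod.lift a b) ≫ prod.fst) =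
      sec (ι k) ((f ≫ prod.lift a b) ≫ prod.snd) := hf
    rw [Category.assoc, Category.assoc, prod.lift_fst, prod.lift_snd] at hf'
    rw [sec_comp, sec_comp] at hf'
    exact hf'
  · refine h.factors_of_mem hab S _ fun V f hf => ?_
    have hf' : sec (ι k) (f ≫ a) = sec (ι k) (f ≫ b) := by
      rw [sec_comp, sec_comp]
      exact hf
    obtain ⟨p, hp⟩ := (hι _ _).1 hf'
    obtain ⟨g, hg, hg'⟩ := (hT p _ _).1 hp
    refine Subobject.factors_of_le _ (hle p) ?_
    rw [prod.comp_lift, ← hg, ← hg', ← prod.comp_lift]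
    exact Subobject.factors_of_factors_right _ ((Subobject.factors_iff _ _).2
      ⟨factorThruImageSubobject _, imageSubobject_arrow_comp _⟩)

end ExactnessConditions

end LocalRepresentability

/-! ### Quotients by equivalence relations -/

section Quotients

variable {C : Type u} [Category.{v} C] [HasFiniteLimits C]

/-- A subobject of `X ⨯ X` that represents an equivalence relation on generalised elements is an
internal equivalence relation. -/
theorem isEquivalenceRelation_of_factors {X : C} (S : Subobject (X ⨯ X))
    (hr : S.Factors (prod.lift (𝟙 X) (𝟙 X)))
    (hs : ∀ {U : C} (a b : U ⟶ X), S.Factors (prod.lift a b) → S.Factors (prod.lift b a))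
    (ht : ∀ {U : C} (a b c : U ⟶ X), S.Factors (prod.lift a b) → S.Factors (prod.lift b c) →
      S.Factors (prod.lift a c)) :
    IsEquivalenceRelation (S.arrow ≫ prod.fst) (S.arrow ≫ prod.snd) := by
  have hS : ∀ {U : C} (g : U ⟶ S), S.Factors
      (prod.lift (g ≫ S.arrow ≫ prod.fst) (g ≫ S.arrow ≫ prod.snd)) := fun g => by
    have : prod.lift (g ≫ S.arrow ≫ prod.fst) (g ≫ S.arrow ≫ prod.snd) = g ≫ S.arrow := by
      ext <;> simp [prod.lift_fst, prod.lift_snd]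
    rw [this]
    exact Subobject.factors_comp_arrow g
  have hS' := hs _ _ (hS (𝟙 _))
  have hS'' := ht _ _ _ (hS (pullback.fst (S.arrow ≫ prod.snd) (S.arrow ≫ prod.fst)))
    (by
      rw [pullback.condition]
      exact hS (pullback.snd (S.arrow ≫ prod.snd) (S.arrow ≫ prod.fst)))
  exact
    ⟨⟨{ right_cancellation := fun _ f g h₁ h₂ => by
          rw [← cancel_mono S.arrow]
          ext <;> simpa
        r := S.factorThru _ hr
        reflexivity₁ := by simp [prod.lift_fst]
        reflexivity₂ := by simp [prod.lift_snd]
        s := S.factorThru _ hS'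
        symmetry₁ := by simp [prod.lift_fst]
        symmetry₂ := by simp [prod.lift_snd]
        c := _
        isLimit := pullbackIsPullback (S.arrow ≫ prod.snd) (S.arrow ≫ prod.fst)
        t := S.factorThru _ hS''
        transitivity₁ := (Subobject.factorThru_arrow_assoc _ _ hS'' _).trans
          (prod.lift_fst _ _)
        transitivity₂ := (Subobject.factorThru_arrow_assoc _ _ hS'' _).trans
          (prod.lift_snd _ _) }⟩⟩

/-- A subobject of `X ⨯ X` that represents an equivalence relation on generalised elements is the
kernel pair of a regular epimorphism. -/
theorem IsBarrExact.exists_quotient (hC : IsBarrExact C) {X : C} (S : Subobject (X ⨯ X))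
    (hr : S.Factors (prod.lift (𝟙 X) (𝟙 X)))
    (hs : ∀ {U : C} (a b : U ⟶ X), S.Factors (prod.lift a b) → S.Factors (prod.lift b a))
    (ht : ∀ {U : C} (a b c : U ⟶ X), S.Factors (prod.lift a b) → S.Factors (prod.lift b c) →
      S.Factors (prod.lift a c)) :
    ∃ (Q : C) (π : X ⟶ Q), IsRegularEpi π ∧ ∀ {U : C} (a b : U ⟶ X),
      a ≫ π = b ≫ π ↔ S.Factors (prod.lift a b) := by
  obtain ⟨⟨e⟩⟩ := hC.effective _ _ (isEquivalenceRelation_of_factors S hr hs ht)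
  refine ⟨e.B, e.π, inferInstance, fun a b => ⟨fun hab => ?_, fun hab => ?_⟩⟩
  · have : prod.lift a b = e.isKernelPair.lift a b hab ≫ S.arrow := by
      ext
      · simp [prod.lift_fst]
      · simp [prod.lift_snd]
    rw [this]
    exact Subobject.factors_comp_arrow _
  · have h₁ := congrArg (S.factorThru _ hab ≫ ·) e.isKernelPair.w
    simpa [prod.lift_fst_assoc, prod.lift_snd_assoc] using h₁

end Quotients

/-! ### Presheaves locally isomorphic to a representable -/

section FilteredUnions

variable {C : Type u} [Category.{v} C] [HasSiftedColimits C]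

/-- The colimit inclusions of a filtered diagram of monomorphisms are monomorphisms. -/
theorem mono_ι_app {J : Type v} [SmallCategory J] [IsFiltered J]
    (hC : FiniteLimitsCommuteWithFilteredColimits C) {F : J ⥤ C}
    [∀ {i j} (f : i ⟶ j), Mono (F.map f)] {c : Cocone F} (hc : IsColimit c) (j : J) :
    Mono (c.ι.app j) := by
  have := hC (Under j)
  have : (colim : (Under j ⥤ C) ⥤ C).PreservesMonomorphisms := inferInstance
  exact hc.mono_ι_app_of_isFiltered j

end FilteredUnions

section LocalEquality

variable {C : Type u} [Category.{v} C] [HasLimitsOfSize.{v, v} C] [HasSiftedColimits C]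
  (h : ExactnessConditions C) {P : Cᵒᵖ ⥤ Type v} {U : C}

namespace ExactnessConditions.LocallyEqual

variable {h}

theorem refl (s : P.obj (Opposite.op U)) : h.LocallyEqual s s :=
  h.topology.superset_covering (fun _ _ _ => rfl) (h.topology.top_mem U)

theorem symm {s t : P.obj (Opposite.op U)} (hst : h.LocallyEqual s t) : h.LocallyEqual t s :=
  h.topology.superset_covering (fun _ _ hf => Eq.symm hf) hst

theorem trans {s t r : P.obj (Opposite.op U)} (hst : h.LocallyEqual s t)
    (htr : h.LocallyEqual t r) : h.LocallyEqual s r :=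
  h.topology.superset_covering (S := _ ⊓ _) (fun _ _ hf => Eq.trans hf.1 hf.2)
    (h.topology.intersection_covering hst htr)

end ExactnessConditions.LocallyEqual

end LocalEquality

section DirectedRepresentability

variable {C : Type u} [Category.{v} C] [HasLimitsOfSize.{v, v} C] [HasSiftedColimits C]

/-- Let `P` be the directed union of the images of morphisms `ι j` from representable presheaves. If
the local kernel pair of each `ι j` is a subobject `S` of `X j ⨯ X j`, then `P` is locally
isomorphic to a representable presheaf: the filtered colimit of the quotients of the `X j` by these
equivalence relations. -/
theorem ExactnessConditions.exists_isLocallyBijective_of_directed (h : ExactnessConditions C)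
    {J : Type v} [Preorder J] [IsDirectedOrder J] [Nonempty J] (X : J → C) {P : Cᵒᵖ ⥤ Type v}
    (ι : ∀ j, yoneda.obj (X j) ⟶ P)
    (hX : ∀ {j l}, j ≤ l → ∃ f : X j ⟶ X l, yoneda.map f ≫ ι l = ι j)
    (hP : ∀ {U : C} (s : P.obj (Opposite.op U)), ∃ (j : J) (a : U ⟶ X j), sec (ι j) a = s)
    (hS : ∀ j, ∃ S : Subobject (X j ⨯ X j), ∀ {U : C} (a b : U ⟶ X j),
      S.Factors (prod.lift a b) ↔ h.LocallyEqual (sec (ι j) a) (sec (ι j) b)) :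
    ∃ (X' : C) (φ : P ⟶ yoneda.obj X'), IsLocallyBijective h.topology φ := by
  have := h.regular
  have hQ : ∀ j, ∃ (Q : C) (π : X j ⟶ Q), IsRegularEpi π ∧ ∀ {U : C} (a b : U ⟶ X j),
      a ≫ π = b ≫ π ↔ h.LocallyEqual (sec (ι j) a) (sec (ι j) b) := by
    intro j
    obtain ⟨S, hS⟩ := hS j
    obtain ⟨Q, π, hπ, H⟩ := h.isBarrExact.exists_quotient S ((hS _ _).2 (.refl _))
      (fun a b hab => (hS _ _).2 ((hS _ _).1 hab).symm)
      (fun a b c hab hbc => (hS _ _).2 (((hS _ _).1 hab).trans ((hS _ _).1 hbc)))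
    exact ⟨Q, π, hπ, fun a b => (H a b).trans (hS a b)⟩
  choose Q π hπ hQ using hQ
  -- transition morphisms between the quotients
  have hq : ∀ {j l} (hjl : j ≤ l), ∃ q : Q j ⟶ Q l, Mono q ∧ ∀ f : X j ⟶ X l,
      yoneda.map f ≫ ι l = ι j → π j ≫ q = f ≫ π l := by
    intro j l hjl
    obtain ⟨f, hf⟩ := hX hjl
    have hsec : ∀ (f : X j ⟶ X l) (_ : yoneda.map f ≫ ι l = ι j) {U : C} (a : U ⟶ X j),
        sec (ι l) (a ≫ f) = sec (ι j) a := fun f hf U a =>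
      ConcreteCategory.congr_hom (NatTrans.congr_app hf (Opposite.op U)) a
    have hff : ∀ {U : C} (a b : U ⟶ X j), a ≫ π j = b ≫ π j ↔ (a ≫ f) ≫ π l = (b ≫ f) ≫ π l := by
      intro U a b
      rw [hQ, hQ, hsec f hf, hsec f hf]
    have hw := (hff _ _).1 (IsRegularEpi.w (π j))
    rw [Category.assoc, Category.assoc] at hw
    have hd := IsRegularEpi.fac (π j) (f ≫ π l) hw
    refine ⟨IsRegularEpi.desc (π j) (f ≫ π l) hw, ⟨fun {T} u v huv => ?_⟩, fun f' hf' => ?_⟩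
    · -- lift `u` and `v` along `π j` after pulling back
      have hu := pullback.condition (f := π j) (g := u)
      have hv := pullback.condition (f := π j) (g := pullback.snd (π j) u ≫ v)
      rw [← cancel_epi (pullback.snd (π j) u),
        ← cancel_epi (pullback.snd (π j) (pullback.snd (π j) u ≫ v)), ← hv, ← hu,
        ← Category.assoc, hff, Category.assoc, Category.assoc, Category.assoc, ← hd,
        reassoc_of% hu, reassoc_of% hv, huv]
    · rw [hd]
      have : 𝟙 _ ≫ f ≫ π l = 𝟙 _ ≫ f' ≫ π l := by
        rw [← Category.assoc, ← Category.assoc, hQ, hsec f hf, hsec f' hf']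
        exact .refl _
      simpa using this
  choose q hqm hq using @hq
  have hqid : ∀ j, q (le_refl j) = 𝟙 _ := fun j => by
    rw [← cancel_epi (π j), hq _ (𝟙 _) (by simp)]
    simp
  have hqcomp : ∀ {j l m} (hjl : j ≤ l) (hlm : l ≤ m), q (hjl.trans hlm) = q hjl ≫ q hlm := by
    intro j l m hjl hlm
    obtain ⟨f, hf⟩ := hX hjl
    obtain ⟨g, hg⟩ := hX hlm
    rw [← cancel_epi (π j), hq _ (f ≫ g) (by simp [hf, hg]), ← Category.assoc, hq hjl f hf,
      Category.assoc, Category.assoc, hq hlm g hg]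
  let F : J ⥤ C :=
    { obj := Q
      map := fun f => q f.le
      map_id := hqid
      map_comp := fun f g => hqcomp f.le g.le }
  have : ∀ {i j : J} (f : i ⟶ j), Mono (F.map f) := fun f => hqm f.le
  obtain ⟨X', r, hr, hrm, hrLUB⟩ : ∃ (X' : C) (r : ∀ j, Q j ⟶ X'),
      (∀ {j l} (hjl : j ≤ l), q hjl ≫ r l = r j) ∧ (∀ j, Mono (r j)) ∧
        ∃ A : J → Subobject X', Directed (· ≤ ·) A ∧ IsLUB (Set.range A) ⊤ ∧
          ∀ j, ∃ e : Q j ⟶ (A j : C), IsIso e ∧ e ≫ (A j).arrow = r j := by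
    have hm := fun j => mono_ι_app h.finiteLimits (colimit.isColimit F) j
    have hm' : ∀ j, Mono (colimit.ι F j) := hm
    have hr : ∀ {j l} (hjl : j ≤ l), q hjl ≫ colimit.ι F l = colimit.ι F j := fun hjl =>
      colimit.w F (homOfLE hjl)
    refine ⟨colimit F, colimit.ι F, hr, hm', fun j => Subobject.mk (colimit.ι F j), ?_, ?_, ?_⟩
    · refine directed_of_isDirected_le fun j l hjl => ?_
      exact Subobject.mk_le_mk_of_comm _ (hr hjl)
    · have := isLUB_mk_of_isColimit (colimit.isColimit F) (𝟙 _)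
        (fun j => Subobject.mk (colimit.ι F j)) (fun f => by
          rw [mk_factors_iff_exists]
          simp)
      have ht : Subobject.mk (𝟙 (colimit.cocone F).pt) = ⊤ := rfl
      rwa [ht] at this
    · exact fun j => ⟨(Subobject.underlyingIso (colimit.ι F j)).inv, inferInstance,
        Subobject.underlyingIso_arrow _⟩
  obtain ⟨A, hA, hA', hA''⟩ := hrLUB
  have hmove : ∀ {j l} (hjl : j ≤ l) {U : C} (a : U ⟶ X j), ∃ a' : U ⟶ X l,
      sec (ι l) a' = sec (ι j) a ∧ a' ≫ π l ≫ r l = a ≫ π j ≫ r j := by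
    intro j l hjl U a
    obtain ⟨f, hf⟩ := hX hjl
    refine ⟨a ≫ f, ConcreteCategory.congr_hom (NatTrans.congr_app hf (Opposite.op U)) a, ?_⟩
    rw [Category.assoc, ← reassoc_of% hq hjl f hf, hr]
  -- sections with equal images in the directed union are locally equal
  have hloc : ∀ {U : C} {j l} (a : U ⟶ X j) (b : U ⟶ X l),
      a ≫ π j ≫ r j = b ≫ π l ≫ r l ↔ h.LocallyEqual (sec (ι j) a) (sec (ι l) b) := by
    intro U j l a b
    obtain ⟨m, hj, hl⟩ := exists_ge_ge j l
    obtain ⟨a', ha, ha'⟩ := hmove hj a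
    obtain ⟨b', hb, hb'⟩ := hmove hl b
    rw [← ha, ← hb, ← ha', ← hb', ← hQ, ← Category.assoc, ← Category.assoc, cancel_mono]
  -- a section of `P` is sent to the image of any of its lifts
  choose j a hja using @hP
  let φ : P ⟶ yoneda.obj X' :=
    { app := fun U => ↾fun s => a (U := U.unop) s ≫ π _ ≫ r _
      naturality := fun U V f => by
        ext s
        have : a (P.map f s) ≫ π _ ≫ r _ = (f.unop ≫ a s) ≫ π _ ≫ r _ := by
          rw [hloc, hja, sec_comp, hja]
          exact .refl _
        exact this.trans (Category.assoc _ _ _) }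
  have hφ : ∀ {U : C} (s : P.obj (Opposite.op U)), φ.app (Opposite.op U) s = a s ≫ π _ ≫ r _ :=
    fun s => rfl
  refine ⟨X', φ, ⟨⟨fun {U} s t hst => ?_⟩, ⟨fun {U} x => ?_⟩⟩⟩
  · have := (hloc _ _).1 hst
    rwa [hja, hja] at this
  · have hcov : Covers (Presheaf.imageSieve φ (U := X') (𝟙 X')) := by
      refine ⟨J, inferInstance, A, hA, hA', fun j => ?_⟩
      obtain ⟨e, he, hej⟩ := hA'' j
      refine ⟨X j, π j ≫ e, isRegularEpi_comp _ _, sec (ι j) (𝟙 _), ?_⟩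
      have : a (sec (ι j) (𝟙 (X j))) ≫ π _ ≫ r _ = (𝟙 _) ≫ π j ≫ r j := by
        rw [hloc, hja]
        exact .refl _
      rw [hφ, this, Category.assoc, hej, Category.id_comp]
      exact (Category.comp_id _).symm
    refine h.topology.superset_covering (fun V f hf => ?_) (h.topology.pullback_stable x hcov)
    obtain ⟨s, hs⟩ := hf
    exact ⟨s, hs.trans (Category.comp_id _)⟩

/-- A sifted colimit of representable presheaves is locally isomorphic to a representable
presheaf. -/
theorem ExactnessConditions.exists_isLocallyBijective_of_representables (h : ExactnessConditions C)
    {K : Type v} [SmallCategory K] [IsSifted K] (X : K ⥤ C) {c : Cocone (X ⋙ yoneda)}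
    (hc : IsColimit c) :
    ∃ (X' : C) (φ : c.pt ⟶ yoneda.obj X'), IsLocallyBijective h.topology φ := by
  have hev := fun U : C => isColimitOfPreserves ((evaluation _ _).obj (Opposite.op U)) hc
  have hι : ∀ {U : C} {k l : K} (a : U ⟶ X.obj k) (b : U ⟶ X.obj l),
      sec (c.ι.app k) a = sec (c.ι.app l) b ↔
      ∃ p : ZigzagPath k l, p.Connects (X ⋙ coyoneda.obj (Opposite.op U)) a b := by
    intro U k l a b
    exact ⟨fun hab => exists_connects (hev U) hab, fun ⟨p, hp⟩ =>
      hp.ι_eq (((evaluation _ _).obj (Opposite.op U)).mapCocone c)⟩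
  -- only the existence of transition morphisms matters; it makes `K` a directed preorder
  let : Preorder K :=
    { le := fun k l => Nonempty (k ⟶ l)
      le_refl := fun k => ⟨𝟙 k⟩
      le_trans := fun _ _ _ ⟨f⟩ ⟨g⟩ => ⟨f ≫ g⟩ }
  have : IsDirectedOrder K := ⟨fun k l => by
    obtain ⟨s⟩ : Nonempty (StructuredArrow (k, l) (Functor.diag K)) := inferInstance
    exact ⟨s.right, ⟨s.hom.1⟩, ⟨s.hom.2⟩⟩⟩
  have : Nonempty K := IsSifted.nonempty
  refine h.exists_isLocallyBijective_of_directed (fun k => X.obj k) (fun k => c.ι.app k) ?_ ?_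
    (h.exists_locallyEqual_iff_factors X _ hι)
  · rintro k l ⟨f⟩
    exact ⟨X.map f, c.w f⟩
  · intro U s
    exact Types.jointly_surjective_of_isColimit (hev U) s

end DirectedRepresentability

/-! ### Colimits of locally bijective morphisms -/

section LocallyBijectiveColimits

variable {C : Type u} [Category.{v} C]

/-- Small colimits of locally bijective morphisms of presheaves are locally bijective. -/
theorem isLocallyBijective_colimit (J : GrothendieckTopology C) {K : Type v} [SmallCategory K]
    {F G : K ⥤ Cᵒᵖ ⥤ Type v} (φ : F ⟶ G) (hφ : ∀ k, IsLocallyBijective J (φ.app k))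
    {c : Cocone F} (hc : IsColimit c) {d : Cocone G} (hd : IsColimit d) (m : c.pt ⟶ d.pt)
    (hm : ∀ k, c.ι.app k ≫ m = φ.app k ≫ d.ι.app k) : IsLocallyBijective J m := by
  have hc' := fun U => isColimitOfPreserves ((evaluation _ _).obj U) hc
  have hd' := fun U => isColimitOfPreserves ((evaluation _ _).obj U) hd
  have hinj := fun k => (hφ k).inj
  have hsurj := fun k => (hφ k).surj
  have hm' : ∀ k {U} (s : (F.obj k).obj U),
      m.app U ((c.ι.app k).app U s) = (d.ι.app k).app U ((φ.app k).app U s) :=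
    fun k U s => ConcreteCategory.congr_hom (NatTrans.congr_app (hm k) U) s
  have hcw : ∀ {k l} (g : k ⟶ l) {U} (s : (F.obj k).obj U),
      (c.ι.app l).app U ((F.map g).app U s) = (c.ι.app k).app U s :=
    fun g U s => ConcreteCategory.congr_hom (NatTrans.congr_app (c.w g) U) s
  have hφw : ∀ {k l} (g : k ⟶ l) {U} (s : (F.obj k).obj U),
      (φ.app l).app U ((F.map g).app U s) = (G.map g).app U ((φ.app k).app U s) :=
    fun g U s => ConcreteCategory.congr_hom (NatTrans.congr_app (φ.naturality g) U) s
  constructor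
  · constructor
    intro U s t hst
    obtain ⟨k, s, rfl⟩ := Types.jointly_surjective_of_isColimit (hc' U) s
    obtain ⟨l, t, rfl⟩ := Types.jointly_surjective_of_isColimit (hc' U) t
    -- `y` locally lifts to a section of `F m` with the image of `s` in the colimit
    let Q : ∀ m, (G.obj m).obj U → Prop := fun m y => ∃ R ∈ J U.unop, ∀ ⦃V : C⦄ (f : V ⟶ U.unop),
      R f → ∃ r : (F.obj m).obj (Opposite.op V), (φ.app m).app _ r = (G.obj m).map f.op y ∧
        (c.ι.app m).app _ r = c.pt.map f.op ((c.ι.app k).app U s)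
    -- this condition is invariant under the transition morphisms, hence it passes from `s` to `t`
    have hQ : ∀ {l m : K} (g : l ⟶ m) (y : (G.obj l).obj U), Q m ((G.map g).app U y) ↔ Q l y := by
      intro l m g y
      constructor
      · rintro ⟨R, hR, H⟩
        let T : Sieve U.unop :=
          { arrows := fun V f => ∃ r : (F.obj l).obj (Opposite.op V),
              (φ.app l).app _ r = (G.obj l).map f.op y ∧
                (c.ι.app l).app _ r = c.pt.map f.op ((c.ι.app k).app U s)
            downward_closed := by
              rintro V W f ⟨r, hr, hr'⟩ a
              refine ⟨(F.obj l).map a.op r, ?_, ?_⟩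
              · rw [NatTrans.naturality_apply, hr]
                simp
              · rw [NatTrans.naturality_apply, hr']
                simp }
        refine ⟨T, J.transitive hR T fun V f hf => ?_, fun V f hf => hf⟩
        obtain ⟨r, hr, hr'⟩ := H f hf
        refine J.transitive (Presheaf.imageSieve_mem J (φ.app l) (U := Opposite.op V)
          ((G.obj l).map f.op y)) _ fun W a ha => ?_
        obtain ⟨r', hr''⟩ := ha
        have hr'' : (φ.app l).app (Opposite.op W) r' =
          (G.obj l).map a.op ((G.obj l).map f.op y) := hr''
        have e : (φ.app m).app _ ((F.map g).app _ r') =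
            (φ.app m).app _ ((F.obj m).map a.op r) := by
          rw [hφw, hr'', NatTrans.naturality_apply (φ.app m), hr,
            NatTrans.naturality_apply (G.map g), NatTrans.naturality_apply (G.map g)]
        refine J.superset_covering (fun X b hb => ?_)
          (Presheaf.equalizerSieve_mem J (φ.app m) _ _ e)
        have hb : (F.obj m).map b.op ((F.map g).app _ r') =
          (F.obj m).map b.op ((F.obj m).map a.op r) := hb
        refine ⟨(F.obj l).map b.op r', ?_, ?_⟩
        · rw [NatTrans.naturality_apply, hr'']
          simp
        · rw [← hcw g, NatTrans.naturality_apply (F.map g), hb, NatTrans.naturality_apply,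
            NatTrans.naturality_apply, hr']
          simp
      · rintro ⟨R, hR, H⟩
        refine ⟨R, hR, fun V f hf => ?_⟩
        obtain ⟨r, hr, hr'⟩ := H f hf
        refine ⟨(F.map g).app _ r, ?_, ?_⟩
        · rw [hφw, hr, NatTrans.naturality_apply]
        · rw [hcw, hr']
    have hst' : (d.ι.app k).app U ((φ.app k).app U s) = (d.ι.app l).app U ((φ.app l).app U t) :=
      (hm' k s).symm.trans (hst.trans (hm' l t))
    obtain ⟨R, hR, H⟩ := (iff_of_ι_eq (hd' U) Q hQ hst').1
      ⟨⊤, J.top_mem _, fun V f _ => ⟨(F.obj k).map f.op s, NatTrans.naturality_apply _ _ _,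
        NatTrans.naturality_apply _ _ _⟩⟩
    refine J.transitive hR _ fun V f hf => ?_
    obtain ⟨r, hr, hr'⟩ := H f hf
    have e : (φ.app l).app _ r = (φ.app l).app _ ((F.obj l).map f.op t) := by
      rw [hr, NatTrans.naturality_apply]
    refine J.superset_covering (fun X b hb => ?_) (Presheaf.equalizerSieve_mem J (φ.app l) _ _ e)
    have hb : (F.obj l).map b.op r = (F.obj l).map b.op ((F.obj l).map f.op t) := hb
    change c.pt.map (b ≫ f).op ((c.ι.app k).app U s) = c.pt.map (b ≫ f).op ((c.ι.app l).app U t)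
    have h₁ := congrArg ((c.ι.app l).app _) hb
    rw [NatTrans.naturality_apply, hr', NatTrans.naturality_apply, NatTrans.naturality_apply] at h₁
    simpa using h₁
  · constructor
    intro U x
    obtain ⟨k, y, rfl⟩ := Types.jointly_surjective_of_isColimit (hd' (Opposite.op U)) x
    refine J.superset_covering (fun V f hf => ?_) (Presheaf.imageSieve_mem J (φ.app k)
      (U := Opposite.op U) y)
    obtain ⟨r, hr⟩ := hf
    refine ⟨(c.ι.app k).app _ r, (hm' k r).trans ?_⟩
    exact (congrArg _ hr).trans (NatTrans.naturality_apply (d.ι.app k) f.op y)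

end LocallyBijectiveColimits

/-! ### Local representability of the closure of the representables -/

section Reflections

variable {C : Type u} [Category.{v} C]

/-- The functor formed by the reflections of the values of a diagram of presheaves. -/
noncomputable def reflectionFunctor {K : Type*} [Category* K] {F : K ⥤ Cᵒᵖ ⥤ Type v} {X : K → C}
    {φ : ∀ k, F.obj k ⟶ yoneda.obj (X k)} (hφ : ∀ k, IsReflection (φ k)) : K ⥤ C where
  obj := X
  map {k l} f := (hφ k (X l) (F.map f ≫ φ l)).choose
  map_id k := (hφ k _ _).unique (hφ k (X k) (F.map (𝟙 k) ≫ φ k)).choose_spec.1 (by simp)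
  map_comp {k l m} f g := (hφ k _ _).unique (hφ k (X m) (F.map (f ≫ g) ≫ φ m)).choose_spec.1 (by
    have key : ∀ (a : X k ⟶ X l) (b : X l ⟶ X m), φ k ≫ yoneda.map a = F.map f ≫ φ l →
        φ l ≫ yoneda.map b = F.map g ≫ φ m →
        φ k ≫ yoneda.map (a ≫ b) = F.map (f ≫ g) ≫ φ m := fun a b h₁ h₂ => by
      rw [Functor.map_comp, Functor.map_comp, Category.assoc, ← h₂, reassoc_of% h₁]
    exact key _ _ (hφ k (X l) (F.map f ≫ φ l)).choose_spec.1
      (hφ l (X m) (F.map g ≫ φ m)).choose_spec.1)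

/-- The reflections of the values of a diagram of presheaves form a natural transformation. -/
noncomputable def reflectionUnit {K : Type*} [Category* K] {F : K ⥤ Cᵒᵖ ⥤ Type v} {X : K → C}
    {φ : ∀ k, F.obj k ⟶ yoneda.obj (X k)} (hφ : ∀ k, IsReflection (φ k)) :
    F ⟶ reflectionFunctor hφ ⋙ yoneda where
  app := φ
  naturality k l f := (hφ k (X l) (F.map f ≫ φ l)).choose_spec.1.symm

variable [HasLimitsOfSize.{v, v} C] [HasSiftedColimits C]

/-- Every presheaf in the closure of the representables under sifted colimits is locally isomorphic
to a representable presheaf. -/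
theorem ExactnessConditions.exists_isLocallyBijective (h : ExactnessConditions C)
    {F : Cᵒᵖ ⥤ Type v} (hF : siftedClosure C F) :
    ∃ (X : C) (φ : F ⟶ yoneda.obj X), IsLocallyBijective h.topology φ := by
  induction hF with
  | of_mem F hF =>
    obtain ⟨X, ⟨e⟩⟩ := hF
    exact ⟨X, e.inv, .of_isIso _ _⟩
  | of_isoClosure e _ ih =>
    obtain ⟨X, φ, hφ⟩ := ih
    exact ⟨X, e.inv ≫ φ, (IsLocallyBijective.of_isIso _ _).comp hφ⟩
  | @of_colimitPresentation F K pres _ ih =>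
    have := K.2
    choose X φ hφ using ih
    have hφ' := fun k => h.isReflection (hφ k)
    let τ := reflectionUnit hφ'
    obtain ⟨X', ψ, hψ⟩ := h.exists_isLocallyBijective_of_representables (reflectionFunctor hφ')
      (colimit.isColimit _)
    -- replace the members of the diagram by their reflections, which form a diagram in `C`
    refine ⟨X', pres.isColimit.desc ((Cocone.precompose τ).obj (colimit.cocone _)) ≫ ψ,
      .comp ?_ hψ⟩
    exact isLocallyBijective_colimit _ τ hφ pres.isColimit (colimit.isColimit _) _
      fun k => pres.isColimit.fac _ k

end Reflections

/-! ### The left adjoint of the restricted Yoneda embedding -/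

section Reflections

variable {C : Type u} [Category.{v} C]

/-- Reflections are unique up to isomorphism. -/
theorem IsReflection.isIso {F : Cᵒᵖ ⥤ Type v} {X X' : C} {φ : F ⟶ yoneda.obj X}
    {ψ : F ⟶ yoneda.obj X'} (hφ : IsReflection φ) (hψ : IsReflection ψ) {f : X ⟶ X'}
    (hf : φ ≫ yoneda.map f = ψ) : IsIso f := by
  obtain ⟨g, hg, -⟩ := hψ X φ
  refine ⟨g, (hφ X φ).unique (y₁ := f ≫ g) (y₂ := 𝟙 _) ?_ ?_,
    (hψ X' ψ).unique (y₁ := g ≫ f) (y₂ := 𝟙 _) ?_ ?_⟩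
  · rw [Functor.map_comp, reassoc_of% hf, hg]
  · simp
  · rw [Functor.map_comp, reassoc_of% hg, hf]
  · simp

/-- The unit of a left adjoint of `W`, as a morphism of presheaves. -/
abbrev unit {L : Sind C ⥤ C} (adj : L ⊣ W C) (F : Sind C) : F.obj ⟶ yoneda.obj (L.obj F) :=
  (adj.unit.app F).hom

theorem unit_naturality {L : Sind C ⥤ C} (adj : L ⊣ W C) {F G : Sind C} (f : F ⟶ G) :
    unit adj F ≫ yoneda.map (L.map f) = f.hom ≫ unit adj G :=
  congrArg (fun a => a.hom) (adj.unit_naturality f)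

theorem isReflection_unit {L : Sind C ⥤ C} (adj : L ⊣ W C) (F : Sind C) :
    IsReflection (unit adj F) := by
  intro Y g
  let g' : F ⟶ (W C).obj Y := ObjectProperty.homMk g
  have key : ∀ f : L.obj F ⟶ Y, unit adj F ≫ yoneda.map f = g ↔ adj.homEquiv F Y f = g' := by
    intro f
    rw [adj.homEquiv_unit]
    exact ⟨fun e => ObjectProperty.hom_ext _ e, fun e => congrArg (fun a => a.hom) e⟩
  refine ⟨(adj.homEquiv F Y).symm g', (key _).2 (by simp), fun f hf => ?_⟩
  rw [Equiv.eq_symm_apply]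
  exact (key f).1 hf

/-- Limits of presheaves in the closure of the representables are computed sectionwise. -/
theorem isSectionwiseLimit_of_isLimit_sind {I : Type v} [SmallCategory I] {F : I ⥤ Sind C}
    {c : Cone F} (hc : IsLimit c) :
    IsSectionwiseLimit (F := F ⋙ (siftedClosure C).ι) (P := c.pt.obj) fun i => (c.π.app i).hom where
  w a := congrArg (fun b => b.hom) (c.w a)
  ext {U s t} hst := by
    let s' : (W C).obj U.unop ⟶ c.pt := ObjectProperty.homMk (yonedaEquiv.symm s)
    let t' : (W C).obj U.unop ⟶ c.pt := ObjectProperty.homMk (yonedaEquiv.symm t)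
    have : s' = t' := hc.hom_ext fun i => ObjectProperty.hom_ext _ (by
      change yonedaEquiv.symm s ≫ (c.π.app i).hom = yonedaEquiv.symm t ≫ (c.π.app i).hom
      apply yonedaEquiv.injective
      rw [yonedaEquiv_comp, yonedaEquiv_comp, Equiv.apply_symm_apply, Equiv.apply_symm_apply]
      exact hst i)
    exact yonedaEquiv.symm.injective (congrArg (fun b => b.hom) this)
  exists_lift {U} x hx := by
    let s : Cone F :=
      { pt := (W C).obj U.unop
        π :=
          { app := fun i => ObjectProperty.homMk (yonedaEquiv.symm (x i))
            naturality := fun i j a => by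
              apply ObjectProperty.hom_ext
              apply yonedaEquiv.injective
              change yonedaEquiv (𝟙 _ ≫ yonedaEquiv.symm (x j)) =
                yonedaEquiv (yonedaEquiv.symm (x i) ≫ (F.map a).hom)
              rw [Category.id_comp, yonedaEquiv_comp, Equiv.apply_symm_apply,
                Equiv.apply_symm_apply]
              exact (hx a).symm } }
    refine ⟨yonedaEquiv (hc.lift s).hom, fun i => ?_⟩
    have h₁ : (hc.lift s).hom ≫ (c.π.app i).hom = yonedaEquiv.symm (x i) :=
      congrArg (fun b => b.hom) (hc.fac s i)
    exact (yonedaEquiv_comp _ _).symm.trans ((congrArg yonedaEquiv h₁).trans (by simp))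

variable [HasLimitsOfSize.{v, v} C] [HasSiftedColimits C]

/-- Every reflection of a presheaf in the closure of the representables is locally bijective: it
differs by an isomorphism from a locally bijective one. -/
theorem ExactnessConditions.isLocallyBijective (h : ExactnessConditions C) {F : Cᵒᵖ ⥤ Type v}
    (hF : siftedClosure C F) {X : C} {ψ : F ⟶ yoneda.obj X} (hψ : IsReflection ψ) :
    IsLocallyBijective h.topology ψ := by
  obtain ⟨X', φ, hφ⟩ := h.exists_isLocallyBijective hF
  obtain ⟨f, hf, -⟩ := h.isReflection hφ X ψ
  have := (h.isReflection hφ).isIso hψ hf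
  rw [← hf]
  exact hφ.comp (.of_isIso _ _)

/-- The restricted Yoneda embedding has a left adjoint, because every presheaf in the closure has a
reflection. -/
theorem ExactnessConditions.isRightAdjoint_W (h : ExactnessConditions C) :
    (W C).IsRightAdjoint := by
  apply Functor.isRightAdjoint_of_leftAdjointObjIsDefined_eq_top
  ext F
  simp only [Pi.top_apply, Prop.top_eq_true, iff_true]
  obtain ⟨X, φ, hφ⟩ := h.exists_isLocallyBijective F.property
  have hφ' := h.isReflection hφ
  refine ⟨X, ⟨?_⟩⟩
  exact
    { homEquiv := fun {Y} => Equiv.ofBijective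
        (fun f => (ObjectProperty.homMk (φ ≫ yoneda.map f) : F ⟶ (W C).obj Y))
        ⟨fun f g hfg => (hφ' _ _).unique rfl (congrArg (fun b => b.hom) hfg).symm, fun g => by
          obtain ⟨f, hf, -⟩ := hφ' Y g.hom
          exact ⟨f, ObjectProperty.hom_ext _ hf⟩⟩
      homEquiv_comp := fun g f => by
        apply ObjectProperty.hom_ext
        change φ ≫ yoneda.map (f ≫ g) = (φ ≫ yoneda.map f) ≫ yoneda.map g
        simp }

/-- The left adjoint preserves small limits: a limit of units is locally bijective, hence again a
reflection. -/
theorem ExactnessConditions.preservesLimits (h : ExactnessConditions C) {L : Sind C ⥤ C}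
    (adj : L ⊣ W C) : PreservesLimitsOfSize.{v, v} L := by
  refine ⟨fun {I} _ => ⟨fun {F} => ⟨fun {c} hc => ?_⟩⟩⟩
  let τ : F ⋙ (siftedClosure C).ι ⟶ (F ⋙ L) ⋙ yoneda :=
    { app := fun i => unit adj (F.obj i)
      naturality := fun i j a => (unit_naturality adj (F.map a)).symm }
  have hτ : ∀ i, IsLocallyBijective h.topology (τ.app i) := fun i =>
    h.isLocallyBijective (F.obj i).property (isReflection_unit adj (F.obj i))
  let d := limit.cone (F ⋙ L)
  let f : L.obj c.pt ⟶ d.pt := (limit.isLimit (F ⋙ L)).lift (L.mapCone c)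
  have hf : ∀ i, f ≫ d.π.app i = L.map (c.π.app i) := fun i =>
    (limit.isLimit (F ⋙ L)).fac (L.mapCone c) i
  have hm := h.isLocallyBijective_limit τ hτ (isSectionwiseLimit_of_isLimit_sind hc)
    (isSectionwiseLimit_of_isLimit (isLimitOfPreserves yoneda (limit.isLimit (F ⋙ L))))
    (unit adj c.pt ≫ yoneda.map f) (fun i => by
      change (unit adj c.pt ≫ yoneda.map f) ≫ yoneda.map (d.π.app i) =
        (c.π.app i).hom ≫ unit adj (F.obj i)
      rw [Category.assoc, ← Functor.map_comp, hf, unit_naturality])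
  have : IsIso f := (isReflection_unit adj c.pt).isIso (h.isReflection hm) rfl
  exact ⟨IsLimit.ofPointIso (limit.isLimit (F ⋙ L)) (i := this)⟩

theorem ExactnessConditions.isAlgebraicallyExact (h : ExactnessConditions C) :
    IsAlgebraicallyExact C :=
  have := h.isRightAdjoint_W
  ⟨_, ⟨Adjunction.ofIsRightAdjoint (W C)⟩, h.preservesLimits (Adjunction.ofIsRightAdjoint (W C))⟩

end Reflections

/-! ### Reflexive coequalisers are sifted colimits -/

section ReflexivePairs

open WalkingReflexivePair WalkingReflexivePair.Hom in
/-- Reflexive pairs are sifted: the category of cospans under a pair of objects is connected by a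
reduction to the cospans with vertex `zero`. -/
instance isSifted_walkingReflexivePair : IsSifted WalkingReflexivePair where
  nonempty := ⟨zero⟩
  out := by
    rintro ⟨a, b⟩
    -- every object maps to one of the form `(zero, u, v)`
    have key : ∀ (p : Set (StructuredArrow (a, b) (Functor.diag WalkingReflexivePair))),
        (∀ {j₁ j₂} (_ : j₁ ⟶ j₂), j₁ ∈ p ↔ j₂ ∈ p) →
        (∀ (u : a ⟶ zero) (v : b ⟶ zero), StructuredArrow.mk (T := Functor.diag _)
          (Y := zero) ((u, v) : (a, b) ⟶ (zero, zero)) ∈ p) → ∀ j, j ∈ p := by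
      rintro p hp h₀ ⟨⟨⟨⟩⟩, z, ⟨u, v⟩⟩
      cases z with
      | zero => exact h₀ u v
      | one =>
        have e := hp (j₁ := StructuredArrow.mk (T := Functor.diag _) (Y := one)
          ((u, v) : (a, b) ⟶ (one, one))) (j₂ := StructuredArrow.mk (T := Functor.diag _)
          (Y := zero) ((u ≫ left, v ≫ left) : (a, b) ⟶ (zero, zero)))
          (StructuredArrow.homMk left rfl)
        exact e.2 (h₀ _ _)
    -- `(zero, u ≫ left, v ≫ left)` and `(zero, u ≫ right, v ≫ right)` are connected
    have conn : ∀ (p : Set (StructuredArrow (a, b) (Functor.diag WalkingReflexivePair))),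
        (∀ {j₁ j₂} (_ : j₁ ⟶ j₂), j₁ ∈ p ↔ j₂ ∈ p) → ∀ (u : a ⟶ one) (v : b ⟶ one),
        (StructuredArrow.mk (T := Functor.diag _) (Y := zero)
          ((u ≫ left, v ≫ left) : (a, b) ⟶ (zero, zero)) ∈ p ↔
        StructuredArrow.mk (T := Functor.diag _) (Y := zero)
          ((u ≫ right, v ≫ right) : (a, b) ⟶ (zero, zero)) ∈ p) := by
      intro p hp u v
      have e₁ := hp (j₁ := StructuredArrow.mk (T := Functor.diag _) (Y := one)
        ((u, v) : (a, b) ⟶ (one, one))) (j₂ := StructuredArrow.mk (T := Functor.diag _)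
        (Y := zero) ((u ≫ left, v ≫ left) : (a, b) ⟶ (zero, zero)))
        (StructuredArrow.homMk left rfl)
      have e₂ := hp (j₁ := StructuredArrow.mk (T := Functor.diag _) (Y := one)
        ((u, v) : (a, b) ⟶ (one, one))) (j₂ := StructuredArrow.mk (T := Functor.diag _)
        (Y := zero) ((u ≫ right, v ≫ right) : (a, b) ⟶ (zero, zero)))
        (StructuredArrow.homMk right rfl)
      exact e₁.symm.trans e₂
    cases a with
    | zero =>
      cases b with
      | zero =>
        refine IsConnected.of_induct (j₀ := StructuredArrow.mk (T := Functor.diag _)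
          (Y := zero) ((𝟙 _, 𝟙 _) : (zero, zero) ⟶ (zero, zero))) fun p h₁ h₂ => ?_
        refine key p h₂ fun u v => ?_
        rcases u with ⟨⟩
        rcases v with ⟨⟩
        exact h₁
      | one =>
        refine IsConnected.of_induct (j₀ := StructuredArrow.mk (T := Functor.diag _)
          (Y := zero) ((𝟙 _, left) : (zero, one) ⟶ (zero, zero))) fun p h₁ h₂ => ?_
        have h₃ := (conn p h₂ reflexion (𝟙 _)).1 h₁
        refine key p h₂ fun u v => ?_
        rcases u with ⟨⟩
        rcases v with _ | _
        · exact h₁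
        · exact h₃
    | one =>
      cases b with
      | zero =>
        refine IsConnected.of_induct (j₀ := StructuredArrow.mk (T := Functor.diag _)
          (Y := zero) ((left, 𝟙 _) : (one, zero) ⟶ (zero, zero))) fun p h₁ h₂ => ?_
        have h₃ := (conn p h₂ (𝟙 _) reflexion).1 h₁
        refine key p h₂ fun u v => ?_
        rcases v with ⟨⟩
        rcases u with _ | _
        · exact h₁
        · exact h₃
      | one =>
        refine IsConnected.of_induct (j₀ := StructuredArrow.mk (T := Functor.diag _)
          (Y := zero) ((left, left) : (one, one) ⟶ (zero, zero))) fun p h₁ h₂ => ?_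
        have h₃ := (conn p h₂ (𝟙 _) (𝟙 _)).1 h₁
        have h₄ := (conn p h₂ (𝟙 _) (left ≫ reflexion)).1 h₁
        have h₅ := (conn p h₂ (left ≫ reflexion) (𝟙 _)).1 h₁
        refine key p h₂ fun u v => ?_
        rcases u with _ | _ <;> rcases v with _ | _
        · exact h₁
        · exact h₅
        · exact h₄
        · exact h₃

end ReflexivePairs

/-! ### Quotient presheaves and image presheaves -/

section Closure

variable {C : Type u} [Category.{v} C]

theorem siftedClosure_of_isColimit {K : Type v} [SmallCategory K] [hK : IsSifted K]
    {F : K ⥤ Cᵒᵖ ⥤ Type v} (hF : ∀ k, siftedClosure C (F.obj k)) {c : Cocone F}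
    (hc : IsColimit c) : siftedClosure C c.pt :=
  .of_colimitPresentation (a := (⟨Cat.of K, hK⟩ : SiftedShape.{v}))
    (pres := ⟨F, c.ι, hc⟩) hF

/-- `WalkingReflexivePair` lives in `Type`, so it is lifted to the universe `v` before the closure
under small sifted colimits applies. -/
theorem siftedClosure_of_isColimit_walkingReflexivePair
    {F : WalkingReflexivePair ⥤ Cᵒᵖ ⥤ Type v}
    (hF : ∀ k, siftedClosure C (F.obj k)) {c : Cocone F} (hc : IsColimit c) :
    siftedClosure C c.pt :=
  have : IsSifted (AsSmall.{v} WalkingReflexivePair) :=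
    IsSifted.isSifted_iff_asSmallIsSifted.1 inferInstance
  siftedClosure_of_isColimit (F := AsSmall.down ⋙ F) (c := c.whisker _) (fun _ => hF _)
    ((Functor.Final.isColimitWhiskerEquiv (AsSmall.equiv.{0, 0, v}.inverse) c).symm hc)

/-- A morphism of presheaves `θ : yoneda.obj X ⟶ G` exhibits `G` as the sectionwise quotient of `X`
by the relation `p, q : R ⟶ X`. -/
structure IsExactQuotient {R X : C} (p q : R ⟶ X) {G : Cᵒᵖ ⥤ Type v} (θ : yoneda.obj X ⟶ G) :
    Prop where
  surj : ∀ {U : C} (s : G.obj (Opposite.op U)), ∃ a : U ⟶ X, sec θ a = s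
  sec_eq_iff : ∀ {U : C} (a b : U ⟶ X), sec θ a = sec θ b ↔ ∃ g : U ⟶ R, g ≫ p = a ∧ g ≫ q = b

namespace IsExactQuotient

variable {R X : C} {p q : R ⟶ X} {G : Cᵒᵖ ⥤ Type v} {θ : yoneda.obj X ⟶ G}

theorem w (hθ : IsExactQuotient p q θ) : yoneda.map p ≫ θ = yoneda.map q ≫ θ := by
  ext U g
  exact (hθ.sec_eq_iff _ _).2 ⟨g, rfl, rfl⟩

theorem hom_ext (hθ : IsExactQuotient p q θ) {H : Cᵒᵖ ⥤ Type v} {d d' : G ⟶ H}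
    (h : θ ≫ d = θ ≫ d') : d = d' := by
  ext U s
  obtain ⟨a, rfl⟩ := hθ.surj (U := U.unop) s
  exact ConcreteCategory.congr_hom (NatTrans.congr_app h U) a

theorem exists_desc (hθ : IsExactQuotient p q θ) {H : Cᵒᵖ ⥤ Type v} (ψ : yoneda.obj X ⟶ H)
    (hψ : yoneda.map p ≫ ψ = yoneda.map q ≫ ψ) : ∃ d : G ⟶ H, θ ≫ d = ψ := by
  choose a ha using @hθ.surj
  have key : ∀ {U : C} (a b : U ⟶ X), sec θ a = sec θ b → sec ψ a = sec ψ b := by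
    intro U a b hab
    obtain ⟨g, rfl, rfl⟩ := (hθ.sec_eq_iff _ _).1 hab
    exact ConcreteCategory.congr_hom (NatTrans.congr_app hψ (Opposite.op U)) g
  refine ⟨{ app := fun U => ↾fun s => sec ψ (a (U := U.unop) s), naturality := ?_ }, ?_⟩
  · intro U V f
    ext s
    refine (key (a (G.map f s)) (f.unop ≫ a s) ?_).trans (sec_comp _ _ _)
    rw [ha, sec_comp, ha]
    rfl
  · ext U b
    exact key _ _ (ha _)

/-- The quotient presheaf lies in the closure of the representables, as a reflexive coequaliser of
representables. -/
theorem siftedClosure (hθ : IsExactQuotient p q θ) : siftedClosure C G := by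
  obtain ⟨r, hr, hr'⟩ := (hθ.sec_eq_iff (𝟙 X) (𝟙 X)).1 rfl
  let F := reflexivePair (yoneda.map p) (yoneda.map q) (yoneda.map r)
    (by rw [← Functor.map_comp, hr, CategoryTheory.Functor.map_id])
    (by rw [← Functor.map_comp, hr', CategoryTheory.Functor.map_id])
  let c : ReflexiveCofork F := ReflexiveCofork.mk θ hθ.w
  have hs : ∀ s : ReflexiveCofork F, ∃ d : G ⟶ s.pt, θ ≫ d = s.π := fun s =>
    hθ.exists_desc s.π s.condition
  choose d hd using hs
  have hc : IsColimit c :=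
    { desc := d
      fac := fun s j => by
        cases j with
        | zero => exact hd s
        | one =>
          exact ((congrArg (· ≫ d s) (c.w .left)).symm.trans (Category.assoc _ _ _)).trans
            ((congrArg (F.map .left ≫ ·) (hd s)).trans (s.w .left))
      uniq := fun s m hm => hθ.hom_ext ((hm .zero).trans (hd s).symm) }
  refine siftedClosure_of_isColimit_walkingReflexivePair (fun k => ?_) hc
  cases k
  · exact siftedClosure_yoneda C X
  · exact siftedClosure_yoneda C R

/-- The reflection of the quotient presheaf is the coequaliser. -/
theorem isReflection_iff (hθ : IsExactQuotient p q θ) {Y : C} {φ : G ⟶ yoneda.obj Y} {π : X ⟶ Y}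
    (hπ : θ ≫ φ = yoneda.map π) :
    IsReflection φ ↔ ∀ (Z : C) (k : X ⟶ Z), p ≫ k = q ≫ k → ∃! l : Y ⟶ Z, π ≫ l = k := by
  have key : ∀ {Z : C} (l : Y ⟶ Z) (g : G ⟶ yoneda.obj Z) (k : X ⟶ Z) (_ : θ ≫ g = yoneda.map k),
      φ ≫ yoneda.map l = g ↔ π ≫ l = k := by
    intro Z l g k hk
    rw [← (yoneda (C := C)).map_injective.eq_iff (a := π ≫ l), Functor.map_comp,
      ← hπ, ← hk, Category.assoc]
    exact ⟨fun h => by rw [h], fun h => hθ.hom_ext h⟩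
  constructor
  · intro hφ Z k hk
    obtain ⟨g, hg⟩ := hθ.exists_desc (yoneda.map k) (by
      rw [← Functor.map_comp, hk, Functor.map_comp])
    exact (existsUnique_congr fun l => key l g k hg).1 (hφ Z g)
  · intro h Z g
    obtain ⟨k, hk⟩ := yoneda.map_surjective (θ ≫ g)
    refine (existsUnique_congr fun l => key l g k hk.symm).2 (h Z k ?_)
    apply yoneda.map_injective
    rw [Functor.map_comp, Functor.map_comp, hk, ← Category.assoc, hθ.w, Category.assoc]

end IsExactQuotient

/-- Equivalence relations have sectionwise quotients. -/
theorem exists_isExactQuotient [HasPullbacks C] {R X : C} (p q : R ⟶ X)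
    (h : IsEquivalenceRelation p q) :
    ∃ (G : Cᵒᵖ ⥤ Type v) (θ : yoneda.obj X ⟶ G), IsExactQuotient p q θ := by
  obtain ⟨⟨e⟩⟩ := h
  let s : ∀ U : C, Setoid (U ⟶ X) := fun U =>
    { r := fun a b => ∃ g : U ⟶ R, g ≫ p = a ∧ g ≫ q = b
      iseqv :=
        { refl := fun a => ⟨a ≫ e.r, by simp, by simp⟩
          symm := by
            rintro _ _ ⟨g, rfl, rfl⟩
            exact ⟨g ≫ e.s, by rw [Category.assoc, e.symmetry₁], by
              rw [Category.assoc, e.symmetry₂]⟩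
          trans := by
            rintro _ _ _ ⟨g, rfl, rfl⟩ ⟨g', h, rfl⟩
            refine ⟨PullbackCone.IsLimit.lift e.isLimit g g' h.symm ≫ e.t, ?_, ?_⟩
            · rw [Category.assoc, e.transitivity₁, PullbackCone.IsLimit.lift_fst_assoc]
            · rw [Category.assoc, e.transitivity₂, PullbackCone.IsLimit.lift_snd_assoc] } }
  have hs : ∀ {U V : C} (f : V ⟶ U) (a b : U ⟶ X), (s U).r a b → (s V).r (f ≫ a) (f ≫ b) := by
    rintro U V f _ _ ⟨g, rfl, rfl⟩
    exact ⟨f ≫ g, by simp, by simp⟩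
  let G : Cᵒᵖ ⥤ Type v :=
    { obj := fun U => Quotient (s U.unop)
      map := fun f => ↾Quotient.map (fun a => f.unop ≫ a) (hs f.unop)
      map_id := fun U => by
        ext x
        induction x using Quotient.ind
        exact congrArg (Quotient.mk _) (Category.id_comp _)
      map_comp := fun f g => by
        ext x
        induction x using Quotient.ind
        exact congrArg (Quotient.mk _) (Category.assoc _ _ _) }
  let θ : yoneda.obj X ⟶ G := { app := fun U => ↾fun a => Quotient.mk (s U.unop) a }
  exact ⟨G, θ, fun {U} x => Quotient.exists_rep x, fun {U} a b => Quotient.eq (r := s U)⟩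

/-- The image presheaf of a morphism is the sectionwise quotient by its kernel pair. -/
theorem isExactQuotient_toRange {R X Y : C} {f : X ⟶ Y} {p q : R ⟶ X} (h : IsKernelPair f p q) :
    IsExactQuotient p q (Subfunctor.toRange (yoneda.map f)) where
  surj := by
    rintro U ⟨_, a, rfl⟩
    exact ⟨a, rfl⟩
  sec_eq_iff {U} a b := by
    have h₁ : sec (Subfunctor.toRange (yoneda.map f)) a =
        sec (Subfunctor.toRange (yoneda.map f)) b ↔ a ≫ f = b ≫ f := Subtype.ext_iff
    rw [h₁]
    refine ⟨fun hab => ⟨h.lift a b hab, by simp, by simp⟩, ?_⟩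
    rintro ⟨g, rfl, rfl⟩
    simp [h.w]

variable [HasPullbacks C]

/-- Image presheaves lie in the closure of the representables. -/
theorem siftedClosure_range {X Y : C} (f : X ⟶ Y) :
    siftedClosure C (Subfunctor.range (yoneda.map f)).toFunctor :=
  (isExactQuotient_toRange (IsPullback.of_hasPullback f f)).siftedClosure

/-- A morphism is a regular epimorphism exactly if the inclusion of its image presheaf is a
reflection. -/
theorem isReflection_range_iff {X Y : C} (f : X ⟶ Y) :
    IsReflection (Subfunctor.range (yoneda.map f)).ι ↔ IsRegularEpi f := by
  have hf : IsKernelPair f (pullback.fst f f) (pullback.snd f f) := IsPullback.of_hasPullback f f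
  rw [(isExactQuotient_toRange hf).isReflection_iff (π := f) rfl]
  constructor
  · intro h
    choose d hd hd' using h
    have hc : IsColimit (Cofork.ofπ f hf.w) := Cofork.IsColimit.mk _
      (fun s => d _ s.π s.condition) (fun s => hd _ s.π s.condition)
      (fun s m hm => hd' _ s.π s.condition m hm)
    exact ⟨⟨Cofork.IsColimit.regularEpi hc⟩⟩
  · intro h Z k hk
    obtain ⟨l, hl⟩ := Cofork.IsColimit.desc' hf.toCoequalizer' k hk
    exact ⟨l, hl, fun l' hl' => Cofork.IsColimit.hom_ext hf.toCoequalizer' (hl'.trans hl.symm)⟩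

end Closure

/-! ### Reflections of colimits, products and pullbacks -/

section ReflectionsAndColimits

variable {C : Type u} [Category.{v} C]

theorem isReflection_id (X : C) : IsReflection (𝟙 (yoneda.obj X)) := by
  intro Y g
  obtain ⟨f, rfl⟩ := yoneda.map_surjective g
  exact ⟨f, Category.id_comp _, fun f' hf' => yoneda.map_injective (by simpa using hf')⟩

theorem IsReflection.comp_isIso {F : Cᵒᵖ ⥤ Type v} {X X' : C} {φ : F ⟶ yoneda.obj X}
    (hφ : IsReflection φ) (f : X ⟶ X') [IsIso f] : IsReflection (φ ≫ yoneda.map f) := by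
  intro Y g
  obtain ⟨k, hk, hk'⟩ := hφ Y g
  refine ⟨inv f ≫ k, ?_, fun k' hk'' => ?_⟩
  · dsimp only
    rw [Category.assoc, ← Functor.map_comp, IsIso.hom_inv_id_assoc]
    exact hk
  · rw [IsIso.eq_inv_comp]
    refine hk' _ ?_
    dsimp only at hk'' ⊢
    rw [Functor.map_comp, ← Category.assoc, hk'']

section

variable {K : Type*} [Category* K] {X : K ⥤ C} {c : Cocone X} {Y : K ⥤ Cᵒᵖ ⥤ Type v}
  (e : X ⋙ yoneda ⟶ Y) {d : Cocone Y} {φ : d.pt ⟶ yoneda.obj c.pt}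

/-- A colimit in `C` reflects the colimit of the corresponding representable presheaves. -/
theorem isReflection_of_isColimit [∀ k, IsIso (e.app k)] (hd : IsColimit d) (hc : IsColimit c)
    (hφ : ∀ k, e.app k ≫ d.ι.app k ≫ φ = yoneda.map (c.ι.app k)) : IsReflection φ := by
  intro Z g
  have hs : ∀ k, ∃ s : X.obj k ⟶ Z, yoneda.map s = e.app k ≫ d.ι.app k ≫ g := fun k =>
    yoneda.map_surjective (e.app k ≫ d.ι.app k ≫ g)
  choose s hs using hs
  have hw : ∀ {k l} (f : k ⟶ l), X.map f ≫ s l = s k := fun {k l} f => by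
    apply yoneda.map_injective
    have h₁ := e.naturality f
    dsimp only [Functor.comp_map] at h₁
    rw [Functor.map_comp, hs, hs, reassoc_of% h₁, reassoc_of% d.w f]
  let t : Cocone X := { pt := Z, ι := { app := s, naturality := fun k l f => by simp [hw] } }
  have key : ∀ l : c.pt ⟶ Z, φ ≫ yoneda.map l = g ↔ ∀ k, c.ι.app k ≫ l = s k := by
    intro l
    have h₁ : ∀ k, c.ι.app k ≫ l = s k ↔ d.ι.app k ≫ φ ≫ yoneda.map l = d.ι.app k ≫ g := by
      intro k
      rw [← (yoneda (C := C)).map_injective.eq_iff (a := c.ι.app k ≫ l), Functor.map_comp, hs, ← hφ,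
        Category.assoc, cancel_epi, Category.assoc]
    exact ⟨fun h k => (h₁ k).2 (by rw [h]), fun h => hd.hom_ext fun k => (h₁ k).1 (h k)⟩
  exact ⟨hc.desc t, (key _).2 (hc.fac t), fun l hl => hc.uniq t l ((key l).1 hl)⟩

/-- Conversely, an object that reflects the colimit of representable presheaves is the colimit of
the representing objects. -/
theorem isColimit_of_isReflection [∀ k, IsIso (e.app k)] (hd : IsColimit d) (hr : IsReflection φ)
    (hφ : ∀ k, e.app k ≫ d.ι.app k ≫ φ = yoneda.map (c.ι.app k)) : Nonempty (IsColimit c) := by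
  have H : ∀ t : Cocone X, ∃! l : c.pt ⟶ t.pt, ∀ k, c.ι.app k ≫ l = t.ι.app k := by
    intro t
    let t' : Cocone Y :=
      { pt := yoneda.obj t.pt
        ι :=
          { app := fun k => inv (e.app k) ≫ yoneda.map (t.ι.app k)
            naturality := fun k l f => by
              have h₁ := e.naturality f
              have h₂ := t.w f
              dsimp only [Functor.comp_map] at h₁
              dsimp only [Functor.const_obj_obj, Functor.const_obj_map]
              rw [Category.comp_id, ← cancel_epi (e.app k), ← reassoc_of% h₁,
                IsIso.hom_inv_id_assoc, IsIso.hom_inv_id_assoc, ← Functor.map_comp, h₂] } }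
    have ht : ∀ k, e.app k ≫ d.ι.app k ≫ hd.desc t' = yoneda.map (t.ι.app k) := by
      intro k
      rw [hd.fac]
      exact IsIso.hom_inv_id_assoc _ _
    have key : ∀ l : c.pt ⟶ t.pt, φ ≫ yoneda.map l = hd.desc t' ↔
        ∀ k, c.ι.app k ≫ l = t.ι.app k := by
      intro l
      have h₁ : ∀ k, c.ι.app k ≫ l = t.ι.app k ↔
          d.ι.app k ≫ φ ≫ yoneda.map l = d.ι.app k ≫ hd.desc t' := by
        intro k
        rw [← (yoneda (C := C)).map_injective.eq_iff (a := c.ι.app k ≫ l), Functor.map_comp, ← ht,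
          ← hφ, Category.assoc, cancel_epi, Category.assoc]
      exact ⟨fun h k => (h₁ k).2 (by rw [h]), fun h => hd.hom_ext fun k => (h₁ k).1 (h k)⟩
    exact (existsUnique_congr key).1 (hr t.pt (hd.desc t'))
  choose l hl hl' using H
  exact ⟨{ desc := l, fac := hl, uniq := hl' }⟩

end

section

/-- A reflection of `F` is isomorphic to the value at `F` of a left adjoint of `W`. -/
theorem exists_isIso_of_isReflection {L : Sind C ⥤ C} (adj : L ⊣ W C) (F : Sind C)
    {X : C} {φ : F.obj ⟶ yoneda.obj X}
    (hφ : IsReflection φ) : ∃ f : L.obj F ⟶ X, IsIso f ∧ unit adj F ≫ yoneda.map f = φ := by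
  obtain ⟨f, hf, -⟩ := isReflection_unit adj F X φ
  exact ⟨f, (isReflection_unit adj F).isIso hφ hf, hf⟩

/-- If the left adjoint of `W` preserves products, then products of reflections are reflections. -/
theorem isReflection_of_isLimit_fan {L : Sind C ⥤ C} (adj : L ⊣ W C) {ι : Type v}
    [PreservesLimitsOfShape (Discrete ι) L]
    {F : ι → Cᵒᵖ ⥤ Type v} (hF : ∀ i, siftedClosure C (F i)) {X : ι → C}
    {φ : ∀ i, F i ⟶ yoneda.obj (X i)} (hφ : ∀ i, IsReflection (φ i)) {P : Cᵒᵖ ⥤ Type v}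
    (hP : siftedClosure C P) {p : ∀ i, P ⟶ F i} (hp : IsLimit (Fan.mk P p)) {Z : C}
    {z : ∀ i, Z ⟶ X i} (hz : IsLimit (Fan.mk Z z)) {m : P ⟶ yoneda.obj Z}
    (hm : ∀ i, m ≫ yoneda.map (z i) = p i ≫ φ i) : IsReflection m := by
  let F' : ι → Sind C := fun i => ⟨F i, hF i⟩
  let P' : Sind C := ⟨P, hP⟩
  let p' : ∀ i, P' ⟶ F' i := fun i => ObjectProperty.homMk (p i)
  have hp' : IsLimit (Fan.mk P' p') := Fan.IsLimit.mk _
    (fun s => ObjectProperty.homMk (hp.lift (Fan.mk s.pt.obj fun i => (s.proj i).hom)))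
    (fun s i => ObjectProperty.hom_ext _ (hp.fac (Fan.mk s.pt.obj fun i => (s.proj i).hom) ⟨i⟩))
    (fun s l hl => ObjectProperty.hom_ext _ (Fan.IsLimit.hom_ext hp _ _ fun i =>
      (congrArg (fun b => b.hom) (hl i)).trans
        (hp.fac (Fan.mk s.pt.obj fun i => (s.proj i).hom) ⟨i⟩).symm))
  have hL := isLimitFanMkObjOfIsLimit L _ _ hp'
  have hy := isLimitFanMkObjOfIsLimit yoneda _ _ hz
  choose ψ hψ hψ' using fun i => exists_isIso_of_isReflection adj (F' i) (hφ i)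
  obtain ⟨f, hf⟩ : ∃ f : L.obj P' ⟶ Z, ∀ i, f ≫ z i = L.map (p' i) ≫ ψ i :=
    ⟨Fan.IsLimit.lift hz fun i => L.map (p' i) ≫ ψ i, fun i => Fan.IsLimit.fac hz _ i⟩
  obtain ⟨g, hg⟩ : ∃ g : Z ⟶ L.obj P', ∀ i, g ≫ L.map (p' i) = z i ≫ inv (ψ i) :=
    ⟨Fan.IsLimit.lift hL fun i => z i ≫ inv (ψ i), fun i => Fan.IsLimit.fac hL _ i⟩
  have : IsIso f := by
    refine ⟨g, Fan.IsLimit.hom_ext hL _ _ fun i => ?_, Fan.IsLimit.hom_ext hz _ _ fun i => ?_⟩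
    · change (f ≫ g) ≫ L.map (p' i) = 𝟙 _ ≫ L.map (p' i)
      rw [Category.assoc, hg, reassoc_of% hf]
      simp
    · change (g ≫ f) ≫ z i = 𝟙 _ ≫ z i
      rw [Category.assoc, hf, reassoc_of% hg]
      simp
  have : m = unit adj P' ≫ yoneda.map f := Fan.IsLimit.hom_ext hy _ _ fun i => by
    change m ≫ yoneda.map (z i) = (unit adj P' ≫ yoneda.map f) ≫ yoneda.map (z i)
    rw [Category.assoc, ← Functor.map_comp, hf, hm, Functor.map_comp, ← hψ', ← Category.assoc,
      ← Category.assoc, unit_naturality]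
    rfl
  rw [this]
  exact (isReflection_unit adj P').comp_isIso f

/-- If the left adjoint of `W` preserves pullbacks, then it sends pullbacks of presheaves to
pullbacks of their reflections. -/
theorem isPullback_of_isReflection {L : Sind C ⥤ C} (adj : L ⊣ W C)
    [PreservesLimitsOfShape WalkingCospan L]
    {P F₁ F₂ F₃ : Cᵒᵖ ⥤ Type v} (hP : siftedClosure C P) (hF₁ : siftedClosure C F₁)
    (hF₂ : siftedClosure C F₂) (hF₃ : siftedClosure C F₃)
    {a : P ⟶ F₁} {b : P ⟶ F₂} {f : F₁ ⟶ F₃} {g : F₂ ⟶ F₃} (h : IsPullback a b f g)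
    {Z X₁ X₂ X₃ : C} {φP : P ⟶ yoneda.obj Z} (hφP : IsReflection φP)
    {φ₁ : F₁ ⟶ yoneda.obj X₁} (hφ₁ : IsReflection φ₁) {φ₂ : F₂ ⟶ yoneda.obj X₂}
    (hφ₂ : IsReflection φ₂) {φ₃ : F₃ ⟶ yoneda.obj X₃} (hφ₃ : IsReflection φ₃)
    {a' : Z ⟶ X₁} {b' : Z ⟶ X₂} {f' : X₁ ⟶ X₃} {g' : X₂ ⟶ X₃}
    (ha : φP ≫ yoneda.map a' = a ≫ φ₁) (hb : φP ≫ yoneda.map b' = b ≫ φ₂)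
    (hf : φ₁ ≫ yoneda.map f' = f ≫ φ₃) (hg : φ₂ ≫ yoneda.map g' = g ≫ φ₃) :
    IsPullback a' b' f' g' := by
  let P' : Sind C := ⟨P, hP⟩
  let F₁' : Sind C := ⟨F₁, hF₁⟩
  let F₂' : Sind C := ⟨F₂, hF₂⟩
  let F₃' : Sind C := ⟨F₃, hF₃⟩
  let a₁ : P' ⟶ F₁' := ObjectProperty.homMk a
  let b₁ : P' ⟶ F₂' := ObjectProperty.homMk b
  let f₁ : F₁' ⟶ F₃' := ObjectProperty.homMk f
  let g₁ : F₂' ⟶ F₃' := ObjectProperty.homMk g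
  have h' : IsPullback a₁ b₁ f₁ g₁ :=
    IsPullback.of_map (siftedClosure C).ι (ObjectProperty.hom_ext _ h.w) h
  obtain ⟨eP, hP, heP⟩ := exists_isIso_of_isReflection adj P' hφP
  obtain ⟨e₁, h₁, he₁⟩ := exists_isIso_of_isReflection adj F₁' hφ₁
  obtain ⟨e₂, h₂, he₂⟩ := exists_isIso_of_isReflection adj F₂' hφ₂
  obtain ⟨e₃, h₃, he₃⟩ := exists_isIso_of_isReflection adj F₃' hφ₃
  have key : ∀ {F G : Sind C} (k : F ⟶ G) {X Y : C} {φ : F.obj ⟶ yoneda.obj X}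
      {ψ : G.obj ⟶ yoneda.obj Y} {eF : L.obj F ⟶ X} {eG : L.obj G ⟶ Y} {k' : X ⟶ Y}
      (_ : unit adj F ≫ yoneda.map eF = φ) (_ : unit adj G ≫ yoneda.map eG = ψ)
      (_ : φ ≫ yoneda.map k' = k.hom ≫ ψ), L.map k ≫ eG = eF ≫ k' := by
    intro F G k X Y φ ψ eF eG k' hF hG hk
    refine (isReflection_unit adj F Y (k.hom ≫ ψ)).unique ?_ ?_
    · rw [Functor.map_comp, ← hG, ← Category.assoc, ← Category.assoc, unit_naturality]
    · rw [Functor.map_comp, ← hk, ← hF, Category.assoc]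
  exact IsPullback.of_iso (h'.map L) (asIso eP) (asIso e₁) (asIso e₂) (asIso e₃)
    (key a₁ heP he₁ ha) (key b₁ heP he₂ hb) (key f₁ he₁ he₃ hf) (key g₁ he₂ he₃ hg)

end

end ReflectionsAndColimits

/-! ### Barr-exactness and products of regular epimorphisms -/

section Exactness

variable {C : Type u} [Category.{v} C] [HasLimitsOfSize.{v, v} C]

/-- If the left adjoint of `W` preserves pullbacks, then every equivalence relation is effective:
its quotient presheaf has it as kernel pair, and so has its reflection. -/
theorem isEffectiveEquivalenceRelation {L : Sind C ⥤ C} (adj : L ⊣ W C)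
    [PreservesLimitsOfShape WalkingCospan L] {R X : C} (p q : R ⟶ X)
    (h : IsEquivalenceRelation p q) : IsEffectiveEquivalenceRelation p q := by
  obtain ⟨G, θ, hθ⟩ := exists_isExactQuotient p q h
  obtain ⟨⟨e⟩⟩ := h
  let G' : Sind C := ⟨G, hθ.siftedClosure⟩
  have hφ := isReflection_unit adj G'
  obtain ⟨π, hπ⟩ := yoneda.map_surjective (θ ≫ unit adj G')
  have hsq : IsPullback (yoneda.map p) (yoneda.map q) θ θ := by
    have hl : ∀ s : PullbackCone θ θ, ∃ l : s.pt ⟶ yoneda.obj R,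
        l ≫ yoneda.map p = s.fst ∧ l ≫ yoneda.map q = s.snd := by
      intro s
      have hs : ∀ {U} (x : s.pt.obj U), ∃ g : U.unop ⟶ R, g ≫ p = s.fst.app U x ∧
          g ≫ q = s.snd.app U x := fun {U} x => (hθ.sec_eq_iff _ _).1
            (ConcreteCategory.congr_hom (NatTrans.congr_app s.condition U) x)
      choose g hg hg' using @hs
      refine ⟨{ app := fun U => ↾fun x => g x, naturality := fun U V f => ?_ }, ?_, ?_⟩
      · ext x
        refine e.right_cancellation (g (s.pt.map f x)) (f.unop ≫ g x) ?_ ?_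
        · rw [hg, Category.assoc, hg, NatTrans.naturality_apply]
          rfl
        · rw [hg', Category.assoc, hg', NatTrans.naturality_apply]
          rfl
      · ext U x
        exact hg x
      · ext U x
        exact hg' x
    choose l hl hl' using hl
    refine ⟨⟨hθ.w⟩, ⟨PullbackCone.IsLimit.mk _ l hl hl' fun s m hm hm' => ?_⟩⟩
    ext U x
    refine e.right_cancellation (m.app U x) ((l s).app U x) ?_ ?_
    · exact ConcreteCategory.congr_hom (NatTrans.congr_app (hm.trans (hl s).symm) U) x
    · exact ConcreteCategory.congr_hom (NatTrans.congr_app (hm'.trans (hl' s).symm) U) x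
  have hk : IsPullback p q π π :=
    isPullback_of_isReflection adj (siftedClosure_yoneda C R) (siftedClosure_yoneda C X)
      (siftedClosure_yoneda C X) hθ.siftedClosure hsq (isReflection_id R) (isReflection_id X)
      (isReflection_id X) hφ (by simp) (by simp) (by simpa using hπ) (by simpa using hπ)
  have hc := (hθ.isReflection_iff hπ.symm).1 hφ
  have hpo : IsPushout p q π π := by
    -- a cocone under the relation has equal legs, because the relation is reflexive
    have hs : ∀ s : PushoutCocone p q, s.inl = s.inr := fun s => by
      have := congrArg (e.r ≫ ·) s.condition
      simpa [reassoc_of% e.reflexivity₁, reassoc_of% e.reflexivity₂] using this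
    choose l hl hl' using fun s : PushoutCocone p q =>
      hc s.pt s.inl (s.condition.trans (congrArg (q ≫ ·) (hs s)).symm)
    exact ⟨⟨hk.w⟩, ⟨PushoutCocone.IsColimit.mk _ l hl (fun s => (hl s).trans (hs s))
      fun s m hm _ => hl' s m hm⟩⟩
  exact ⟨⟨{ e with B := _, π := π, isKernelPair := hk, isPushout := hpo }⟩⟩

/-- Regular epimorphisms are stable under pullback: the image presheaf of the pulled back morphism
is the pullback of the image presheaf, so its inclusion is again a reflection. -/
theorem isRegularEpi_of_isPullback {L : Sind C ⥤ C} (adj : L ⊣ W C)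
    [PreservesLimitsOfShape WalkingCospan L] {X Y X' Z : C} {a : X' ⟶ X} {f' : X' ⟶ Z} {f : X ⟶ Y}
    {g : Z ⟶ Y} (h : IsPullback a f' f g) (hf : IsRegularEpi f) : IsRegularEpi f' := by
  rw [← isReflection_range_iff] at hf ⊢
  let A := Subfunctor.range (yoneda.map f)
  let B := Subfunctor.range (yoneda.map f')
  have hmem : ∀ {U : C} (b : U ⟶ Z), b ∈ B.obj (Opposite.op U) ↔ b ≫ g ∈ A.obj (Opposite.op U) := by
    intro U b
    constructor
    · rintro ⟨c, rfl⟩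
      refine ⟨c ≫ a, ?_⟩
      change (c ≫ a) ≫ f = (c ≫ f') ≫ g
      rw [Category.assoc, Category.assoc, h.w]
    · rintro ⟨c, hc⟩
      exact ⟨h.lift c b hc, h.lift_snd c b hc⟩
  have hsq : ∃ t : B.toFunctor ⟶ A.toFunctor, IsPullback t B.ι A.ι (yoneda.map g) := by
    refine ⟨Subfunctor.lift (B.ι ≫ yoneda.map g) ?_, ⟨⟨Subfunctor.lift_ι _ _⟩,
      ⟨PullbackCone.IsLimit.mk _ (fun s => Subfunctor.lift s.snd ?_) (fun s => ?_) (fun s => ?_)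
        fun s m _ hm => ?_⟩⟩⟩
    · rintro U _ ⟨x, rfl⟩
      exact (hmem x.1).1 x.2
    · rintro U _ ⟨x, rfl⟩
      refine (hmem _).2 ?_
      have := ConcreteCategory.congr_hom (NatTrans.congr_app s.condition U) x
      have h₂ := ((s.fst.app U x)).2
      exact Set.mem_of_eq_of_mem this.symm h₂
    · rw [← cancel_mono A.ι]
      exact s.condition.symm
    · rfl
    · rw [← cancel_mono B.ι]
      exact hm
  obtain ⟨t, hsq⟩ := hsq
  let B' : Sind C := ⟨B.toFunctor, siftedClosure_range f'⟩
  have hB := isReflection_unit adj B'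
  obtain ⟨b, hb, -⟩ := hB Z B.ι
  obtain ⟨k, hk, -⟩ := hB Y (t ≫ A.ι)
  have := isPullback_of_isReflection adj B'.property (siftedClosure_range f)
    (siftedClosure_yoneda C Z) (siftedClosure_yoneda C Y) hsq hB hf (isReflection_id Z)
    (isReflection_id Y) (a' := k) (b' := b) (f' := 𝟙 Y) (g' := g) hk (by simpa using hb)
    (by simp [A]) (by simp)
  have := this.isIso_snd_of_isIso
  have h₁ := hB.comp_isIso b
  rwa [hb] at h₁

/-- If the left adjoint of `W` preserves pullbacks, then `C` is Barr-exact. Kernel pairs have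
coequalisers because they are effective equivalence relations. -/
theorem isBarrExact_of_preservesLimits {L : Sind C ⥤ C} (adj : L ⊣ W C)
    [PreservesLimitsOfShape WalkingCospan L] : IsBarrExact C where
  regular :=
    { toHasFiniteLimits := inferInstance
      hasCoequalizer_of_isKernelPair := fun {X Y Z f g₁ g₂} h => by
        obtain ⟨⟨e⟩⟩ := isEffectiveEquivalenceRelation adj g₁ g₂
          (h.equivalenceRelation (t := _) f g₁ g₂ (pullbackIsPullback g₂ g₁)).isEquivalenceRelation
        exact ⟨⟨_, e.isCoequalizer⟩⟩
      regularEpiIsStableUnderBaseChange :=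
        ⟨fun h hg => isRegularEpi_of_isPullback adj h hg⟩ }
  effective p q h := isEffectiveEquivalenceRelation adj p q h

/-- Regular epimorphisms are stable under products: the image presheaf of a product is the product
of the image presheaves, so its inclusion is again a reflection. -/
theorem regularEpisStableUnderProducts {L : Sind C ⥤ C} (adj : L ⊣ W C)
    [PreservesLimitsOfSize.{v, v} L] : RegularEpisStableUnderProducts C := by
  intro ι X Y f hf
  simp only [← isReflection_range_iff] at hf ⊢
  let A := fun i => Subfunctor.range (yoneda.map (f i))
  let B := Subfunctor.range (yoneda.map (Limits.Pi.map f))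
  have hY := isLimitFanMkObjOfIsLimit yoneda _ _ (productIsProduct Y)
  have hmem : ∀ {U : C} (b : U ⟶ ∏ᶜ Y), b ∈ B.obj (Opposite.op U) ↔
      ∀ i, b ≫ Pi.π Y i ∈ (A i).obj (Opposite.op U) := by
    intro U b
    constructor
    · rintro ⟨c, rfl⟩ i
      refine ⟨c ≫ Pi.π X i, ?_⟩
      change (c ≫ Pi.π X i) ≫ f i = (c ≫ Limits.Pi.map f) ≫ Pi.π Y i
      simp
    · intro hb
      choose c hc using hb
      refine ⟨Pi.lift c, ?_⟩
      refine Limits.Pi.hom_ext _ _ fun i => ?_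
      have : c i ≫ f i = b ≫ Pi.π Y i := hc i
      change (Pi.lift c ≫ Limits.Pi.map f) ≫ Pi.π Y i = b ≫ Pi.π Y i
      rw [← this]
      simp
  have hr : ∀ i, Subfunctor.range (B.ι ≫ yoneda.map (Pi.π Y i)) ≤ A i := by
    rintro i U _ ⟨x, rfl⟩
    exact (hmem x.1).1 x.2 i
  have hB : IsLimit (Fan.mk B.toFunctor fun i =>
      Subfunctor.lift (B.ι ≫ yoneda.map (Pi.π Y i)) (hr i)) := by
    have hs : ∀ s : Fan fun i => (A i).toFunctor, ∃ l : s.pt ⟶ B.toFunctor,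
        ∀ i, l ≫ B.ι ≫ yoneda.map (Pi.π Y i) = s.proj i ≫ (A i).ι := by
      intro s
      obtain ⟨l, hl⟩ : ∃ l : s.pt ⟶ yoneda.obj (∏ᶜ Y),
          ∀ i, l ≫ yoneda.map (Pi.π Y i) = s.proj i ≫ (A i).ι :=
        ⟨Fan.IsLimit.lift hY fun i => s.proj i ≫ (A i).ι, fun i => Fan.IsLimit.fac hY _ i⟩
      refine ⟨Subfunctor.lift l ?_, hl⟩
      rintro U _ ⟨x, rfl⟩
      refine (hmem _).2 fun i => ?_
      have := ConcreteCategory.congr_hom (NatTrans.congr_app (hl i) U) x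
      exact Set.mem_of_eq_of_mem this ((s.proj i).app U x).2
    choose l hl using hs
    refine Fan.IsLimit.mk _ l (fun s i => ?_) (fun s m hm => ?_)
    · rw [← cancel_mono (A i).ι]
      exact hl s i
    · rw [← cancel_mono B.ι]
      refine Fan.IsLimit.hom_ext hY _ _ fun i => ?_
      exact (congrArg (· ≫ (A i).ι) (hm i)).trans (hl s i).symm
  exact isReflection_of_isLimit_fan adj (fun i => siftedClosure_range (f i)) hf
    (siftedClosure_range _) hB (productIsProduct Y) fun i => rfl

end Exactness

/-! ### Filtered colimits, finite limits and products -/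

section ProductComparison

variable {C : Type u} [Category.{v} C] [HasProducts.{v} C] {ι : Type v}

theorem yoneda_map_piMap {x x' : ι → C} (f : ∀ i, x i ⟶ x' i) :
    yoneda.map (Limits.Pi.map f) ≫ piComparison yoneda x' =
      piComparison yoneda x ≫ Limits.Pi.map fun i => yoneda.map (f i) := by
  refine Limits.Pi.hom_ext _ _ fun i => ?_
  simp [← Functor.map_comp]

/-- If `m` is the product of the morphisms `φ i`, up to the identification of the Yoneda embedding
of a product with the product of presheaves, then its composite with the product of the `δ i` is the
product of the composites. -/
theorem piComparison_comp_piMap_comp {x X : ι → C} {P : ι → Cᵒᵖ ⥤ Type v}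
    {δ : ∀ i, yoneda.obj (x i) ⟶ P i} {γ : ∀ i, x i ⟶ X i} {φ : ∀ i, P i ⟶ yoneda.obj (X i)}
    (h : ∀ i, δ i ≫ φ i = yoneda.map (γ i)) {m : ∏ᶜ P ⟶ yoneda.obj (∏ᶜ X)}
    (hm : ∀ i, m ≫ yoneda.map (Pi.π X i) = Pi.π P i ≫ φ i) :
    piComparison yoneda x ≫ Limits.Pi.map δ ≫ m = yoneda.map (Limits.Pi.map γ) := by
  refine Fan.IsLimit.hom_ext (isLimitFanMkObjOfIsLimit yoneda _ _ (productIsProduct X)) _ _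
    fun i => ?_
  change (piComparison yoneda x ≫ Limits.Pi.map δ ≫ m) ≫ yoneda.map (Pi.π X i) =
    yoneda.map (Limits.Pi.map γ) ≫ yoneda.map (Pi.π X i)
  rw [Category.assoc, Category.assoc, hm, Limits.Pi.map_π_assoc, h, piComparison_comp_π_assoc,
    ← Functor.map_comp, ← Functor.map_comp, Limits.Pi.map_π]

end ProductComparison

section ColimitComparison

variable {C D : Type*} [Category* C] [Category* D] {K : Type*} [Category* K]
  [HasColimitsOfShape K C] [HasColimitsOfShape K D]

theorem colimit_map_post {X Y : K ⥤ C} (τ : X ⟶ Y) (G : C ⥤ D) :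
    colim.map (Functor.whiskerRight τ G) ≫ colimit.post Y G =
      colimit.post X G ≫ G.map (colim.map τ) := (colimit.map_post _ _).symm

end ColimitComparison

section FilteredColimits

variable {C : Type u} [Category.{v} C] [HasLimitsOfSize.{v, v} C]

/-- If the left adjoint of `W` preserves products, then filtered colimits distribute over products,
because they do so for presheaves. -/
theorem filteredColimitsDistributeOverProducts {L : Sind C ⥤ C} (adj : L ⊣ W C)
    [PreservesLimitsOfSize.{v, v} L] : FilteredColimitsDistributeOverProducts C := by
  intro ι J _ _ F c hc
  let Y : ∀ i, J i ⥤ Cᵒᵖ ⥤ Type v := fun i => F i ⋙ yoneda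
  let d : ∀ i, Cocone (Y i) := fun i => colimit.cocone (Y i)
  have hd : ∀ i, IsColimit (d i) := fun i => colimit.isColimit (Y i)
  have : ∀ i, IsSifted (J i) := fun i => IsFiltered.isSifted
  have : IsSifted (∀ i, J i) := IsFiltered.isSifted
  obtain ⟨hD⟩ := IsIPCOfShape.nonempty_isColimit hd
  let φ : ∀ i, (d i).pt ⟶ yoneda.obj (c i).pt := fun i => (hd i).desc (yoneda.mapCocone (c i))
  have hφ' : ∀ i k, (d i).ι.app k ≫ φ i = yoneda.map ((c i).ι.app k) := fun i k =>
    (hd i).fac (yoneda.mapCocone (c i)) k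
  have hφ : ∀ i, IsReflection (φ i) := fun i =>
    isReflection_of_isColimit (e := 𝟙 (F i ⋙ yoneda)) (hd i) (hc i).some fun k =>
      (Category.id_comp _).trans (hφ' i k)
  let e : pointwiseProduct F ⋙ yoneda ⟶ pointwiseProduct Y :=
    { app := fun k => piComparison yoneda fun i => (F i).obj (k i)
      naturality := fun k l f => yoneda_map_piMap fun i => (F i).map (f i) }
  have he : ∀ k, IsIso (e.app k) := fun k =>
    inferInstanceAs (IsIso (piComparison yoneda fun i => (F i).obj (k i)))
  have hy := isLimitFanMkObjOfIsLimit yoneda _ _ (productIsProduct fun i => (c i).pt)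
  obtain ⟨m, hm⟩ : ∃ m : (coconePointwiseProduct d).pt ⟶ yoneda.obj (coconePointwiseProduct c).pt,
      ∀ i, m ≫ yoneda.map (Pi.π (fun i => (c i).pt) i) = Pi.π (fun i => (d i).pt) i ≫ φ i :=
    ⟨Fan.IsLimit.lift hy fun i => Pi.π (fun i => (d i).pt) i ≫ φ i,
      fun i => Fan.IsLimit.fac hy _ i⟩
  have hP : siftedClosure C (coconePointwiseProduct d).pt :=
    siftedClosure_of_isColimit (fun k =>
      .of_isoClosure (asIso (e.app k)) (siftedClosure_yoneda C _)) hD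
  have hr : IsReflection m := isReflection_of_isLimit_fan adj
    (fun i => siftedClosure_of_isColimit (fun k => siftedClosure_yoneda C _) (hd i)) hφ hP
    (productIsProduct fun i => (d i).pt) (productIsProduct fun i => (c i).pt) hm
  refine isColimit_of_isReflection e hD hr fun k => ?_
  rw [coconePointwiseProduct_ι_app, coconePointwiseProduct_ι_app]
  exact piComparison_comp_piMap_comp (fun i => hφ' i (k i)) hm

variable [HasSiftedColimits C]

/-- If the left adjoint `L` of `W` preserves finite limits, then filtered colimits commute with
finite limits: the colimit of a diagram is the value of `L` at the colimit of the corresponding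
representable presheaves, and filtered colimits of presheaves commute with finite limits. -/
theorem finiteLimitsCommuteWithFilteredColimits {L : Sind C ⥤ C} (adj : L ⊣ W C)
    [PreservesFiniteLimits L] : FiniteLimitsCommuteWithFilteredColimits C := by
  intro K _ _
  have : IsSifted K := IsFiltered.isSifted
  -- `T` sends a diagram to the colimit of its representable presheaves
  let T : (K ⥤ C) ⥤ Cᵒᵖ ⥤ Type v := (Functor.whiskeringRight K C _).obj yoneda ⋙ colim
  have hT : ∀ X, siftedClosure C (T.obj X) := fun X =>
    siftedClosure_of_isColimit (F := X ⋙ yoneda) (fun k => siftedClosure_yoneda C (X.obj k))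
      (colimit.isColimit _)
  let T' : (K ⥤ C) ⥤ Sind C := (siftedClosure C).lift T hT
  have : PreservesFiniteLimits T :=
    ⟨fun J _ _ => by
      have : PreservesLimitsOfShape J (colim : (K ⥤ Cᵒᵖ ⥤ Type v) ⥤ _) := inferInstance
      infer_instance⟩
  have : PreservesFiniteLimits T' :=
    ⟨fun J _ _ =>
      have : PreservesLimitsOfShape J (T' ⋙ (siftedClosure C).ι) :=
        inferInstanceAs (PreservesLimitsOfShape J T)
      preservesLimitsOfShape_of_reflects_of_preserves T' (siftedClosure C).ι⟩
  let ν : T' ⟶ colim ⋙ W C :=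
    { app := fun X => ObjectProperty.homMk (colimit.post X yoneda)
      naturality := fun X Y τ => by
        apply ObjectProperty.hom_ext
        exact (colimit_map_post τ yoneda) }
  have hν : ∀ X : K ⥤ C, IsReflection (colimit.post X yoneda) := fun X =>
    isReflection_of_isColimit (e := 𝟙 (X ⋙ yoneda)) (colimit.isColimit _) (colimit.isColimit X)
      fun k => (Category.id_comp _).trans (colimit.ι_post X yoneda k)
  let τ : T' ⋙ L ⟶ colim := Functor.whiskerRight ν L ≫ Functor.whiskerLeft colim adj.counit
  have hτ : ∀ X, unit adj (T'.obj X) ≫ yoneda.map (τ.app X) = colimit.post X yoneda := by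
    intro X
    have h₁ : unit adj (T'.obj X) ≫ yoneda.map (L.map (ν.app X) ≫ adj.counit.app (colimit X)) =
        (ν.app X).hom := by
      rw [Functor.map_comp, ← Category.assoc, unit_naturality, Category.assoc]
      have h₂ : unit adj ((W C).obj (colimit X)) ≫ yoneda.map (adj.counit.app (colimit X)) = 𝟙 _ :=
        congrArg (fun a => a.hom) (adj.right_triangle_components (colimit X))
      exact (congrArg ((ν.app X).hom ≫ ·) h₂).trans (Category.comp_id _)
    exact h₁
  have : IsIso τ := by
    have := fun X => (isReflection_unit adj (T'.obj X)).isIso (hν X) (hτ X)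
    exact NatIso.isIso_of_isIso_app τ
  exact preservesFiniteLimits_of_natIso (asIso τ)

/-- The exactness conditions hold in `C` because they are instances of compatibilities between
limits and sifted colimits that hold for presheaves and are transported along the left adjoint
of `W`. -/
theorem IsAlgebraicallyExact.exactnessConditions (h : IsAlgebraicallyExact C) :
    ExactnessConditions C := by
  obtain ⟨L, ⟨adj⟩, hL⟩ := h
  have : PreservesFiniteLimits L := PreservesLimitsOfSize.preservesFiniteLimits L
  exact ⟨isBarrExact_of_preservesLimits adj, finiteLimitsCommuteWithFilteredColimits adj,
    regularEpisStableUnderProducts adj, filteredColimitsDistributeOverProducts adj⟩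

end FilteredColimits

end AlgExact

theorem mainTheorem1 (C : Type u) [Category.{v} C] [HasLimitsOfSize.{v, v} C]
    [AlgExact.HasSiftedColimits C] :
    AlgExact.IsAlgebraicallyExact C ↔
      AlgExact.IsBarrExact C ∧
      AlgExact.FiniteLimitsCommuteWithFilteredColimits C ∧
      AlgExact.RegularEpisStableUnderProducts C ∧
      AlgExact.FilteredColimitsDistributeOverProducts C :=
  ⟨fun h =>
    have := h.exactnessConditions
    ⟨this.isBarrExact, this.finiteLimits, this.regularEpis, this.distributive⟩,
    fun ⟨h₁, h₂, h₃, h₄⟩ => AlgExact.ExactnessConditions.isAlgebraicallyExact ⟨h₁, h₂, h₃, h₄⟩⟩
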